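/- Let $n\ge 1$, $\mathbb{T}^n=\mathbb{R}^n/\mathbb{Z}^n$ (functions on $\mathbb{T}^n$ are identified with $\mathbb{Z}^n$-periodic functions on $\mathbb{R}^n$). Let $a\in C^2(\mathbb{T}^n)$ with $a\ge 0$, and let $H\in C^2(\mathbb{T}^n\times\mathbb{R}^n)$ be such that $p\mapsto H(x,p)$ is convex for each $x\in\mathbb{T}^n$, there is $C>0$ with $|D_xH(x,p)|\le C(1+H(x,p))$ for all $(x,p)\in\mathbb{T}^n\times\mathbb{R}^n$, and $H(x,p)/|p|\to+\infty$ as $|p|\to+\infty$, uniformly for $x\in\mathbb{T}^n$. Let $w\in C(\mathbb{T}^n)$ satisfy $$\|Dw\|_{L^\infty(\mathbb{T}^n)}+\|a\Delta w\|_{L^\infty(\mathbb{T}^n)}\le C\quad\text{for some constant } C>0,$$ that is, the distributional gradient $Dw$ and the distribution $a\Delta w$, given by $\langle a\Delta w,\phi\rangle=\int w\,\Delta(a\phi)\,dx$ for $\phi\in C^2$ (compactly supported in $\mathbb{R}^n$), are represented by essentially bounded functions. Then the following are equivalent: 1. $w$ is a viscosity subsolution of $H(x,Dw)=a(x)\Delta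 w$ in $\mathbb{T}^n$: for every $\phi\in C^2(\mathbb{R}^n)$ and every $x_0\in\mathbb{R}^n$ at which $w-\phi$ has a local maximum, $H(x_0,D\phi(x_0))\le a(x_0)\Delta\phi(x_0)$. 2. $w$ is a subsolution in the almost everywhere sense: $H(x,Dw(x))\le a(x)\Delta w(x)$ for almost every $x\in\mathbb{T}^n$, where $Dw$ and $a\Delta w$ are the functions representing these distributions. -/

import Mathlib

open MeasureTheory
open scoped Gradient ENNReal

/-! Functions on the flat torus `ℝⁿ / ℤⁿ` are identified, as usual, with `ℤⁿ`-periodic functions on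
`ℝⁿ`; `C^k` on the torus is `C^k` and periodic on `ℝⁿ`, and "almost everywhere" on the torus is
"almost everywhere" on `ℝⁿ` for the lifted objects. -/

namespace DegenerateHJ

/-- `f` is invariant under all translations by integer vectors, i.e. `f` is a function on the
torus `ℝⁿ / ℤⁿ`. -/
def IsPeriodic {n : ℕ} {β : Type*} (f : EuclideanSpace ℝ (Fin n) → β) : Prop :=
  ∀ (k : Fin n → ℤ) (x : EuclideanSpace ℝ (Fin n)),
    f (x + WithLp.toLp 2 (fun i => (k i : ℝ))) = f x

/-- The standing assumptions on the Hamiltonian `H = H(x, p)` on `𝕋ⁿ × ℝⁿ`. -/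
structure IsHamiltonian {n : ℕ}
    (H : EuclideanSpace ℝ (Fin n) → EuclideanSpace ℝ (Fin n) → ℝ) : Prop where
  /-- `H(·, p)` is a function on the torus. -/
  periodic : IsPeriodic H
  /-- `H` is of class `C²` in `(x, p)` jointly. -/
  contDiff : ContDiff ℝ 2
    (fun z : EuclideanSpace ℝ (Fin n) × EuclideanSpace ℝ (Fin n) => H z.1 z.2)
  /-- `p ↦ H(x, p)` is convex. -/
  convex : ∀ x, ConvexOn ℝ Set.univ (H x)
  /-- `|D_x H(x, p)| ≤ C (1 + H(x, p))`. -/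
  gradient_le : ∃ C : ℝ, 0 < C ∧ ∀ x p, ‖∇ (fun y => H y p) x‖ ≤ C * (1 + H x p)
  /-- `H(x, p) / |p| → +∞` as `|p| → +∞`, uniformly in `x`. -/
  superlinear : ∀ M : ℝ, ∃ R : ℝ, 0 < R ∧ ∀ x p, R ≤ ‖p‖ → M ≤ H x p / ‖p‖

/-- The standing assumptions on the diffusion coefficient: `a ∈ C²(𝕋ⁿ)` and `a ≥ 0`. -/
structure IsDiffusionCoefficient {n : ℕ} (a : EuclideanSpace ℝ (Fin n) → ℝ) : Prop where
  periodic : IsPeriodic a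
  contDiff : ContDiff ℝ 2 a
  nonneg : ∀ x, 0 ≤ a x

/-- `w` is a viscosity subsolution of `H(x, Dw) = a(x) Δw`: whenever `w - φ` has a local maximum
at `x₀` for a `C²` function `φ`, one has `H(x₀, Dφ(x₀)) ≤ a(x₀) Δφ(x₀)`. -/
def IsViscositySubsolution {n : ℕ}
    (H : EuclideanSpace ℝ (Fin n) → EuclideanSpace ℝ (Fin n) → ℝ)
    (a w : EuclideanSpace ℝ (Fin n) → ℝ) : Prop :=
  ∀ (φ : EuclideanSpace ℝ (Fin n) → ℝ) (x₀ : EuclideanSpace ℝ (Fin n)),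
    ContDiff ℝ 2 φ → IsLocalMax (fun x => w x - φ x) x₀ →
      H x₀ (∇ φ x₀) ≤ a x₀ * Laplacian.laplacian φ x₀

/-- The locally integrable vector field `G` is the weak (distributional) gradient `Dw` of `w`:
`∫ w Dφ = - ∫ φ G` for all compactly supported `C¹` functions `φ`. -/
def IsWeakGradient {n : ℕ} (w : EuclideanSpace ℝ (Fin n) → ℝ)
    (G : EuclideanSpace ℝ (Fin n) → EuclideanSpace ℝ (Fin n)) : Prop :=
  LocallyIntegrable G ∧
    ∀ φ : EuclideanSpace ℝ (Fin n) → ℝ, ContDiff ℝ 1 φ → HasCompactSupport φ →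
      ∫ x, w x • ∇ φ x = - ∫ x, φ x • G x

/-- The locally integrable function `g` represents the distribution `a Δw`, the product of the
`C²` function `a` with the distributional Laplacian of `w`: `∫ w Δ(a φ) = ∫ g φ` for all compactly
supported `C²` functions `φ`. -/
def IsWeakMulLaplacian {n : ℕ} (a w g : EuclideanSpace ℝ (Fin n) → ℝ) : Prop :=
  LocallyIntegrable g ∧
    ∀ φ : EuclideanSpace ℝ (Fin n) → ℝ, ContDiff ℝ 2 φ → HasCompactSupport φ →
      ∫ x, w x * Laplacian.laplacian (fun y => a y * φ y) x = ∫ x, g x * φ x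

/-- `‖Dw‖_∞ + ‖a Δw‖_∞ < ∞`: the distributions `Dw` and `a Δw` are (represented by) essentially
bounded functions. -/
def HasBoundedGradientAndMulLaplacian {n : ℕ} (a w : EuclideanSpace ℝ (Fin n) → ℝ) : Prop :=
  ∃ (G : EuclideanSpace ℝ (Fin n) → EuclideanSpace ℝ (Fin n))
    (g : EuclideanSpace ℝ (Fin n) → ℝ),
    IsWeakGradient w G ∧ IsWeakMulLaplacian a w g ∧ MemLp G ∞ ∧ MemLp g ∞

/-- `w` is an almost everywhere subsolution of `H(x, Dw) = a(x) Δw`: the distributions `Dw` and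
`a Δw` are functions (unique up to null sets), and `H(x, Dw(x)) ≤ a(x) Δw(x)` for almost every
`x`. -/
def IsAESubsolution {n : ℕ}
    (H : EuclideanSpace ℝ (Fin n) → EuclideanSpace ℝ (Fin n) → ℝ)
    (a w : EuclideanSpace ℝ (Fin n) → ℝ) : Prop :=
  ∃ (G : EuclideanSpace ℝ (Fin n) → EuclideanSpace ℝ (Fin n))
    (g : EuclideanSpace ℝ (Fin n) → ℝ),
    IsWeakGradient w G ∧ IsWeakMulLaplacian a w g ∧ ∀ᵐ x, H x (G x) ≤ g x

end DegenerateHJ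

set_option linter.unusedSectionVars false

/-! Both directions compare `w` with its mollification `w_ε`, whose gradient is the mollification of
`G = Dw`. The key fact is that `a Δw_ε` differs from the mollification of `g = aΔw` by an error that
is small near each point `x₀` (`exists_abs_mul_laplacian_mollify_sub_le`). If `a x₀ = 0`, then `Da`
vanishes there because `a ≥ 0`, and the commutator is controlled by the local size of `Da`. If `a x₀
> 0`, then `Δw = g / a` is a bounded function near `x₀` and continuity of `a` suffices.

From a.e. to viscosity: Jensen's inequality for the convex `H x` makes `w_ε` a classical subsolution
up to a small error (`exists_mollify_subsolution`). Uniform convergence `w_ε → w` then carries the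
inequality to any test function, as in the usual stability argument
(`isViscositySubsolution_of_ae`).

From viscosity to a.e.: the test function is `w_ε + c|x - x₀|²`, which touches `w` from above up to
a constant at some point within distance `Nε` of `x₀`, provided the paraboloid beats `2 sup |w_ε -
w|` on the sphere of that radius (`IsViscositySubsolution.exists_mem_ball`). The paraboloid must
also perturb the gradient and `aΔ` only slightly. If `a x₀ = 0`, the Lipschitz bound `|w_ε - w| ≤
Kε` suffices, since `a` is at most of order `Nε` nearby and `N` is large. If `a x₀ > 0`, the
second-order bound `|w_ε - w| ≤ Cε²` is needed (`exists_abs_mollify_sub_le_sq`); it comes from a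
radial kernel. At Lebesgue points of `G` and `g` the mollified quantities at the touching points
converge to `G x₀` and `g x₀`, which gives the inequality (`IsViscositySubsolution.ae_le`). -/

namespace DegenerateHJ

/-! ### Second-order calculus: maximum tests, tangent planes, Laplacian and gradient of paraboloids.
-/

section Calculus

variable {E : Type*} [NormedAddCommGroup E] [InnerProductSpace ℝ E]

theorem contDiff_fderiv_apply {f : E → ℝ} (hf : ContDiff ℝ 2 f) (v : E) :
    ContDiff ℝ 1 fun z => fderiv ℝ f z v :=
  (hf.fderiv_right (m := 1) (by norm_num)).clm_apply contDiff_const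

theorem contDiff_const_mul_normSq (c : ℝ) (x₀ : E) {k : WithTop ℕ∞} :
    ContDiff ℝ k fun z : E => c * ‖z - x₀‖ ^ 2 :=
  contDiff_const.mul ((contDiff_id.sub contDiff_const).norm_sq ℝ)

/-- The second derivative test: necessary condition along a direction. -/
theorem fderiv_fderiv_nonpos_of_isLocalMax {f : E → ℝ} (hf : ContDiff ℝ 2 f) {x : E}
    (hx : IsLocalMax f x) (v : E) : fderiv ℝ (fun z => fderiv ℝ f z v) x v ≤ 0 := by
  by_contra! hpos
  set φ : ℝ → ℝ := fun t => f (x + t • v) with hφ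
  have hline : ∀ t : ℝ, HasDerivAt (fun t : ℝ => x + t • v) v t := fun t => by
    simpa using ((hasDerivAt_id t).smul_const v).const_add x
  have h1 : deriv φ = fun t => fderiv ℝ f (x + t • v) v := by
    ext t
    exact (((hf.differentiable two_ne_zero) _).hasFDerivAt.comp_hasDerivAt t (hline t)).deriv
  have h2 : deriv (deriv φ) 0 = fderiv ℝ (fun z => fderiv ℝ f z v) x v := by
    rw [h1]
    have hd := ((contDiff_fderiv_apply hf v).differentiable one_ne_zero (x + (0 : ℝ) • v))
    have := (hd.hasFDerivAt.comp_hasDerivAt 0 (hline 0)).deriv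
    simpa [Function.comp_def] using this
  have hcont : Continuous φ := hf.continuous.comp (by fun_prop)
  have hmax : IsLocalMax φ 0 := by
    have ht : Filter.Tendsto (fun t : ℝ => x + t • v) (nhds 0) (nhds x) := by
      have : Continuous fun t : ℝ => x + t • v := by fun_prop
      simpa using this.tendsto 0
    have := ht.eventually hx
    filter_upwards [this] with t h
    simpa [hφ] using h
  -- A positive second derivative makes the maximum a minimum as well, so `φ` is constant near `0`,
  -- a contradiction.
  have hmin : IsLocalMin φ 0 := isLocalMin_of_deriv_deriv_pos (by rw [h2]; exact hpos)
    hmax.deriv_eq_zero hcont.continuousAt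
  have hconst : φ =ᶠ[nhds 0] fun _ => φ 0 := by
    filter_upwards [hmax, hmin] with t h h' using le_antisymm h h'
  have : deriv (deriv φ) 0 = 0 := by
    have := hconst.deriv.deriv_eq
    simpa using this
  rw [← h2, this] at hpos
  exact lt_irrefl _ hpos

/-- The graph of a differentiable convex function lies above its tangent planes. -/
theorem add_fderiv_le_of_convexOn {f : E → ℝ} (hf : ConvexOn ℝ Set.univ f) {p : E}
    (hd : DifferentiableAt ℝ f p) (q : E) : f p + fderiv ℝ f p (q - p) ≤ f q := by
  set φ : ℝ → ℝ := fun t => f (p + t • (q - p)) with hφ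
  have hline : HasDerivAt (fun t : ℝ => p + t • (q - p)) (q - p) 0 := by
    simpa using ((hasDerivAt_id (0 : ℝ)).smul_const (q - p)).const_add p
  have hder : HasDerivAt φ (fderiv ℝ f p (q - p)) 0 := by
    have hd' : HasFDerivAt f (fderiv ℝ f p) (p + (0 : ℝ) • (q - p)) := by
      simpa using hd.hasFDerivAt
    exact hd'.comp_hasDerivAt 0 hline
  have hconv : ConvexOn ℝ Set.univ φ := by
    have := hf.comp_affineMap (AffineMap.lineMap p q : ℝ →ᵃ[ℝ] E)
    refine (this.congr fun t _ => ?_)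
    simp [hφ, AffineMap.lineMap_apply, add_comm]
  have := hconv.le_slope_of_hasDerivAt (Set.mem_univ 0) (Set.mem_univ 1) one_pos hder
  simp [slope, hφ] at this
  rw [map_sub]
  linarith

variable [FiniteDimensional ℝ E]

theorem laplacian_eq_sum_fderiv {f : E → ℝ} (hf : ContDiff ℝ 2 f) (x : E) :
    Laplacian.laplacian f x = ∑ i, fderiv ℝ (fun z => fderiv ℝ f z (stdOrthonormalBasis ℝ E i)) x
      (stdOrthonormalBasis ℝ E i) := by
  rw [InnerProductSpace.laplacian_eq_iteratedFDeriv_stdOrthonormalBasis]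
  refine Finset.sum_congr rfl fun i _ => ?_
  have hd : DifferentiableAt ℝ (fderiv ℝ f) x :=
    ((hf.fderiv_right (m := 1) (by norm_num)).differentiable one_ne_zero) x
  rw [iteratedFDeriv_two_apply]
  simp [fderiv_clm_apply hd (differentiableAt_const _)]

theorem continuous_laplacian {f : E → ℝ} (hf : ContDiff ℝ 2 f) :
    Continuous (Laplacian.laplacian f : E → ℝ) := by
  have : (Laplacian.laplacian f : E → ℝ) = fun x => ∑ i, fderiv ℝ
      (fun z => fderiv ℝ f z (stdOrthonormalBasis ℝ E i)) x (stdOrthonormalBasis ℝ E i) :=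
    funext (laplacian_eq_sum_fderiv hf)
  rw [this]
  refine continuous_finsetSum _ fun i _ => ?_
  exact ((contDiff_fderiv_apply hf _).continuous_fderiv one_ne_zero).clm_apply continuous_const

theorem continuous_gradient {f : E → ℝ} (hf : ContDiff ℝ 1 f) : Continuous (∇ f) :=
  (InnerProductSpace.toDual ℝ E).symm.continuous.comp (hf.continuous_fderiv one_ne_zero)

theorem hasGradientAt_const_mul_normSq (c : ℝ) (x₀ x : E) :
    HasGradientAt (fun z => c * ‖z - x₀‖ ^ 2) ((2 * c) • (x - x₀)) x := by
  rw [hasGradientAt_iff_hasFDerivAt]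
  have h := (((hasFDerivAt_id x).sub_const x₀).norm_sq).const_mul c
  refine h.congr_fderiv ?_
  ext v
  simp
  ring

theorem laplacian_const_mul_normSq (c : ℝ) (x₀ x : E) :
    Laplacian.laplacian (fun z : E => c * ‖z - x₀‖ ^ 2) x = 2 * c * Module.finrank ℝ E := by
  rw [laplacian_eq_sum_fderiv (contDiff_const_mul_normSq c x₀)]
  have h : ∀ v : E, (fun z => fderiv ℝ (fun z : E => c * ‖z - x₀‖ ^ 2) z v) =
      fun z => (2 * c) * inner ℝ (z - x₀) v := by
    intro v
    ext z
    rw [(hasGradientAt_const_mul_normSq c x₀ z).fderiv_apply, inner_smul_left]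
    simp
  have h2 : ∀ v : E, fderiv ℝ (fun z : E => (2 * c) * inner ℝ (z - x₀) v) x v =
      2 * c * ‖v‖ ^ 2 := by
    intro v
    have := ((((hasFDerivAt_id x).sub_const x₀).inner ℝ (hasFDerivAt_const v x))).const_mul (2 * c)
    refine (congrArg (fun L => L v) (HasFDerivAt.fderiv this)).trans ?_
    simp
  simp only [h, h2]
  simp
  ring

theorem gradient_add_apply {f g : E → ℝ} {x : E} (hf : DifferentiableAt ℝ f x)
    (hg : DifferentiableAt ℝ g x) : ∇ (fun z => f z + g z) x = ∇ f x + ∇ g x := by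
  simp only [gradient]
  rw [fderiv_fun_add hf hg, map_add]

theorem norm_gradient (f : E → ℝ) (x : E) : ‖∇ f x‖ = ‖fderiv ℝ f x‖ := by
  simp [gradient]

theorem gradient_eq_of_isLocalMax_sub {f g : E → ℝ} (hf : ContDiff ℝ 2 f) (hg : ContDiff ℝ 2 g)
    {x : E} (hx : IsLocalMax (fun z => f z - g z) x) : ∇ f x = ∇ g x := by
  have h := hx.fderiv_eq_zero
  rw [fderiv_fun_sub (hf.differentiable two_ne_zero x) (hg.differentiable two_ne_zero x),
    sub_eq_zero] at h
  simp only [gradient, h]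

theorem laplacian_le_of_isLocalMax_sub {f g : E → ℝ} (hf : ContDiff ℝ 2 f) (hg : ContDiff ℝ 2 g)
    {x : E} (hx : IsLocalMax (fun z => f z - g z) x) :
    Laplacian.laplacian f x ≤ Laplacian.laplacian g x := by
  have h := ContDiffAt.laplacian_sub (hf.contDiffAt (x := x)) (hg.contDiffAt (x := x))
  have h0 : Laplacian.laplacian (f - g) x ≤ 0 := by
    rw [laplacian_eq_sum_fderiv (f := f - g) (hf.sub hg)]
    exact Finset.sum_nonpos fun i _ => fderiv_fderiv_nonpos_of_isLocalMax (hf.sub hg) hx _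
  linarith

/-- A continuous function which is larger at the centre of a ball than on its boundary has a local
maximum inside the ball. -/
theorem exists_isLocalMax_mem_ball {f : E → ℝ} (hf : Continuous f) {x₀ : E} {r : ℝ} (hr : 0 < r)
    (h : ∀ x ∈ Metric.sphere x₀ r, f x < f x₀) : ∃ x ∈ Metric.ball x₀ r, IsLocalMax f x := by
  obtain ⟨z, hz, hmin⟩ := Metric.exists_isLocalMin_mem_ball (f := fun x => -f x) (a := x₀) (z := x₀)
    (r := r) hf.neg.continuousOn (Metric.mem_closedBall_self hr.le)
    (fun x hx => neg_lt_neg (h x hx))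
  exact ⟨z, hz, by simpa using hmin.neg⟩

end Calculus

/-! ### Differentiating convolutions with a compactly supported kernel. -/

section Convolution

variable {E : Type*} [NormedAddCommGroup E] [InnerProductSpace ℝ E] [FiniteDimensional ℝ E]
  [MeasureSpace E] [BorelSpace E] [(volume : Measure E).IsAddHaarMeasure]
  {F : Type*} [NormedAddCommGroup F] [NormedSpace ℝ F]

theorem hasCompactSupport_comp_sub_left {k : E → ℝ} (hk : HasCompactSupport k) (x : E) :
    HasCompactSupport fun y => k (x - y) :=
  hk.comp_homeomorph (Homeomorph.subLeft x)

theorem integrable_smul_of_hasCompactSupport {φ : E → ℝ} (hφ : Continuous φ)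
    (hc : HasCompactSupport φ) {f : E → F} (hf : LocallyIntegrable f) :
    Integrable fun y => φ y • f y :=
  hf.integrable_smul_left_of_hasCompactSupport hφ hc

theorem integrable_kernel_smul {k : E → ℝ} (hk : Continuous k) (hc : HasCompactSupport k)
    {f : E → F} (hf : LocallyIntegrable f) (x : E) : Integrable fun y => k (x - y) • f y :=
  integrable_smul_of_hasCompactSupport (hk.comp (continuous_const.sub continuous_id))
    (hasCompactSupport_comp_sub_left hc x) hf

theorem contDiff_integral_kernel {k : E → ℝ} {m : ℕ∞} (hk : ContDiff ℝ m k)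
    (hc : HasCompactSupport k) {f : E → ℝ} (hf : LocallyIntegrable f) :
    ContDiff ℝ m fun x => ∫ y, k (x - y) • f y := by
  have := hc.contDiff_convolution_right (μ := volume) (ContinuousLinearMap.lsmul ℝ ℝ).flip hf hk
  exact this

theorem fderiv_integral_kernel {k : E → ℝ} (hk : ContDiff ℝ 1 k)
    (hc : HasCompactSupport k) {f : E → ℝ} (hf : LocallyIntegrable f) (x v : E) :
    fderiv ℝ (fun x => ∫ y, k (x - y) • f y) x v = ∫ y, fderiv ℝ k (x - y) v • f y := by
  have h := hc.hasFDerivAt_convolution_right (μ := volume)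
    (ContinuousLinearMap.lsmul ℝ ℝ).flip hf hk x
  have h2 := congrArg (fun L => L v) h.fderiv
  have h3 := convolution_precompR_apply (μ := volume) (ContinuousLinearMap.lsmul ℝ ℝ).flip hf
    (hc.fderiv ℝ) (hk.continuous_fderiv one_ne_zero) x v
  exact h2.trans h3

theorem hasCompactSupport_fderiv_apply {k : E → ℝ} (hc : HasCompactSupport k) (v : E) :
    HasCompactSupport fun z => fderiv ℝ k z v :=
  (hc.fderiv ℝ).comp_left (g := fun L : E →L[ℝ] ℝ => L v) rfl

theorem laplacian_integral_kernel {k : E → ℝ} (hk : ContDiff ℝ 2 k)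
    (hc : HasCompactSupport k) {f : E → ℝ} (hf : LocallyIntegrable f) (x : E) :
    Laplacian.laplacian (fun x => ∫ y, k (x - y) • f y) x =
      ∫ y, Laplacian.laplacian k (x - y) • f y := by
  have hk1 : ContDiff ℝ 1 k := hk.of_le one_le_two
  rw [laplacian_eq_sum_fderiv (by exact_mod_cast contDiff_integral_kernel (m := 2) hk hc hf)]
  simp only [laplacian_eq_sum_fderiv hk, Finset.sum_smul]
  rw [integral_finsetSum]
  · refine Finset.sum_congr rfl fun i _ => ?_
    simp only [fderiv_integral_kernel hk1 hc hf]
    exact fderiv_integral_kernel (contDiff_fderiv_apply hk _)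
      (hasCompactSupport_fderiv_apply hc _) hf _ _
  · intro i _
    exact integrable_kernel_smul (((contDiff_fderiv_apply hk _).continuous_fderiv
      one_ne_zero).clm_apply continuous_const)
      (hasCompactSupport_fderiv_apply (hasCompactSupport_fderiv_apply hc _) _) hf x

theorem fderiv_comp_sub_left {k : E → ℝ} (hk : ContDiff ℝ 1 k) (x y v : E) :
    fderiv ℝ (fun y => k (x - y)) y v = -fderiv ℝ k (x - y) v := by
  have h : HasFDerivAt (fun y => x - y) (-ContinuousLinearMap.id ℝ E) y :=
    (hasFDerivAt_id y).const_sub x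
  have := ((hk.differentiable one_ne_zero (x - y)).hasFDerivAt).comp y h
  refine (congrArg (fun L => L v) this.fderiv).trans ?_
  simp

theorem laplacian_comp_sub_left {k : E → ℝ} (hk : ContDiff ℝ 2 k) (x y : E) :
    Laplacian.laplacian (fun y => k (x - y)) y = Laplacian.laplacian k (x - y) := by
  have hk' : ContDiff ℝ 2 fun y => k (x - y) := hk.comp (contDiff_const.sub contDiff_id)
  rw [laplacian_eq_sum_fderiv hk', laplacian_eq_sum_fderiv hk]
  refine Finset.sum_congr rfl fun i _ => ?_
  simp only [fderiv_comp_sub_left (hk.of_le one_le_two)]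
  rw [fderiv_fun_neg]
  simp [fderiv_comp_sub_left (contDiff_fderiv_apply hk _)]

end Convolution

/-! ### The radial kernel, its potential, and the rescaled mollifiers. -/

section Kernel

variable {E : Type*} [NormedAddCommGroup E] [InnerProductSpace ℝ E]

/-- A smooth radial function supported in the unit ball. -/
noncomputable def kernelPotential (y : E) : ℝ := expNegInvGlue (1 - ‖y‖ ^ 2)

/-- The radial function `ρ` with `∇ψ (y) = -ρ(y) y` for `ψ = kernelPotential`. -/
noncomputable def kernelProfile (y : E) : ℝ := 2 * deriv expNegInvGlue (1 - ‖y‖ ^ 2)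

theorem contDiff_kernelPotential : ContDiff ℝ 2 (kernelPotential : E → ℝ) :=
  (expNegInvGlue.contDiff (n := 2)).comp (contDiff_const.sub (contDiff_norm_sq ℝ))

theorem contDiff_kernelProfile : ContDiff ℝ 2 (kernelProfile : E → ℝ) := by
  have h : ContDiff ℝ 2 (deriv expNegInvGlue) :=
    ((contDiff_succ_iff_deriv (n := 2)).1 (expNegInvGlue.contDiff (n := 3))).2.2
  exact contDiff_const.mul (h.comp (contDiff_const.sub (contDiff_norm_sq ℝ)))

theorem kernelPotential_nonneg (y : E) : 0 ≤ kernelPotential y := expNegInvGlue.nonneg _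

theorem kernelProfile_nonneg (y : E) : 0 ≤ kernelProfile y :=
  mul_nonneg zero_le_two expNegInvGlue.monotone.deriv_nonneg

theorem kernelPotential_eq_zero {y : E} (hy : 1 ≤ ‖y‖) : kernelPotential y = 0 :=
  expNegInvGlue.zero_of_nonpos (by nlinarith)

theorem kernelProfile_eq_zero {y : E} (hy : 1 ≤ ‖y‖) : kernelProfile y = 0 := by
  -- The glue function attains its minimum `0` at every nonpositive point, including the boundary
  -- case `‖y‖ = 1`.
  have h : IsLocalMin expNegInvGlue (1 - ‖y‖ ^ 2) := Filter.Eventually.of_forall fun t => by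
    rw [expNegInvGlue.zero_of_nonpos (x := 1 - ‖y‖ ^ 2) (by nlinarith)]
    exact expNegInvGlue.nonneg t
  simp [kernelProfile, h.deriv_eq_zero]

theorem kernelProfile_zero_pos : 0 < kernelProfile (0 : E) := by
  have h : expNegInvGlue =ᶠ[nhds 1] fun x => Real.exp (-x⁻¹) := by
    filter_upwards [lt_mem_nhds (zero_lt_one (α := ℝ))] with x hx
    simp [expNegInvGlue, hx]
  have hd : HasDerivAt (fun x : ℝ => Real.exp (-x⁻¹)) (Real.exp (-1⁻¹) * -(-(1 ^ 2)⁻¹)) 1 :=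
    ((hasDerivAt_inv one_ne_zero).neg).exp
  have : deriv expNegInvGlue 1 = Real.exp (-1⁻¹) * -(-(1 ^ 2)⁻¹) := by
    rw [h.deriv_eq, hd.deriv]
  simp only [kernelProfile, norm_zero]
  norm_num [this, Real.exp_pos]

theorem fderiv_kernelPotential (y v : E) :
    fderiv ℝ kernelPotential y v = -(kernelProfile y * inner ℝ y v) := by
  have h1 : HasDerivAt expNegInvGlue (deriv expNegInvGlue (1 - ‖y‖ ^ 2)) (1 - ‖y‖ ^ 2) :=
    ((expNegInvGlue.contDiff (n := 1)).differentiable one_ne_zero _).hasDerivAt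
  have h2 := (h1.comp_hasFDerivAt y (((hasFDerivAt_id y).norm_sq).const_sub 1)).fderiv
  refine (congrArg (fun L => L v) h2).trans ?_
  simp [kernelProfile]
  ring

theorem hasCompactSupport_of_eq_zero [FiniteDimensional ℝ E] {f : E → ℝ} {r : ℝ}
    (h : ∀ y, r ≤ ‖y‖ → f y = 0) : HasCompactSupport f :=
  HasCompactSupport.intro (isCompact_closedBall 0 r) fun y hy => h y (by
    simpa using (not_le.1 fun h' => hy (by simpa using h')).le)

variable [FiniteDimensional ℝ E] [MeasureSpace E] [BorelSpace E]
  [(volume : Measure E).IsAddHaarMeasure]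

theorem integral_kernelProfile_pos : 0 < ∫ y : E, kernelProfile y :=
  contDiff_kernelProfile.continuous.integral_pos_of_hasCompactSupport_nonneg_nonzero
    (hasCompactSupport_of_eq_zero fun _ => kernelProfile_eq_zero) kernelProfile_nonneg
    (kernelProfile_zero_pos).ne'

/-- The normalised mollifier at scale `ε`. -/
noncomputable def mollifier (ε : ℝ) (z : E) : ℝ :=
  (ε ^ Module.finrank ℝ E)⁻¹ * (kernelProfile (ε⁻¹ • z) / ∫ y : E, kernelProfile y)

theorem contDiff_mollifier (ε : ℝ) : ContDiff ℝ 2 (mollifier ε : E → ℝ) :=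
  contDiff_const.mul ((contDiff_kernelProfile.comp (contDiff_const_smul _)).div_const _)

theorem mollifier_eq_zero {ε : ℝ} (hε : 0 < ε) {z : E} (hz : ε ≤ ‖z‖) : mollifier ε z = 0 := by
  have : 1 ≤ ‖ε⁻¹ • z‖ := by
    rw [norm_smul, norm_inv, Real.norm_of_nonneg hε.le, inv_mul_eq_div]
    exact (one_le_div hε).2 hz
  simp [mollifier, kernelProfile_eq_zero this]

theorem hasCompactSupport_mollifier {ε : ℝ} (hε : 0 < ε) :
    HasCompactSupport (mollifier ε : E → ℝ) :=
  hasCompactSupport_of_eq_zero fun _ => mollifier_eq_zero hε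

theorem mollifier_nonneg {ε : ℝ} (hε : 0 < ε) (z : E) : 0 ≤ mollifier ε z :=
  mul_nonneg (by positivity) (div_nonneg (kernelProfile_nonneg _) integral_kernelProfile_pos.le)

theorem integral_mollifier {ε : ℝ} (hε : 0 < ε) : ∫ z : E, mollifier ε z = 1 := by
  have hm := (integral_kernelProfile_pos (E := E)).ne'
  simp only [mollifier]
  rw [integral_const_mul, Measure.integral_comp_inv_smul_of_nonneg volume
    (fun z : E => kernelProfile z / ∫ y : E, kernelProfile y) hε.le, integral_div, div_self hm]
  simp [hε.ne']

theorem integral_mollifier_sub_left {ε : ℝ} (hε : 0 < ε) (x : E) :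
    ∫ y : E, mollifier ε (x - y) = 1 := by
  rw [integral_sub_left_eq_self (mollifier ε) volume x, integral_mollifier hε]

/-- Both sides scale like `ε` to the power minus the dimension. This lets ball averages dominate
mollifications, as Lebesgue points require. -/
theorem exists_mollifier_le : ∃ C : ℝ, 0 < C ∧ ∀ ε : ℝ, 0 < ε → ∀ x z : E,
    mollifier ε z ≤ C / (volume : Measure E).real (Metric.closedBall x ε) := by
  obtain ⟨B, hB⟩ := (hasCompactSupport_of_eq_zero fun _ => kernelProfile_eq_zero (E := E)
    ).exists_bound_of_continuous contDiff_kernelProfile.continuous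
  have hm := integral_kernelProfile_pos (E := E)
  have hV : 0 < (volume : Measure E).real (Metric.closedBall 0 1) :=
    ENNReal.toReal_pos (Metric.measure_closedBall_pos _ _ one_pos).ne' measure_closedBall_lt_top.ne
  have hB0 : 0 < B := kernelProfile_zero_pos.trans_le ((le_abs_self _).trans (hB 0))
  refine ⟨B / (∫ y : E, kernelProfile y) * (volume : Measure E).real (Metric.closedBall 0 1),
    by positivity, fun ε hε x z => ?_⟩
  rw [Measure.addHaar_real_closedBall' volume x hε.le, mul_div_mul_right _ _ hV.ne', mollifier,
    inv_mul_eq_div]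
  gcongr
  exact (le_abs_self _).trans (hB _)

/-- The `L¹` norm of the mollifier's derivative scales like `1/ε`; in the commutator the factor `a x
- a y = O(ε)` absorbs it. -/
theorem integral_norm_fderiv_mollifier : ∃ C : ℝ, 0 < C ∧ ∀ ε : ℝ, 0 < ε → ∀ x : E,
    ε * ∫ y : E, ‖fderiv ℝ (mollifier ε) (x - y)‖ ≤ C := by
  refine ⟨(∫ y : E, ‖fderiv ℝ (fun z : E => kernelProfile z / ∫ y : E, kernelProfile y) y‖) + 1,
    by positivity, fun ε hε x => ?_⟩
  set k : E → ℝ := fun z : E => kernelProfile z / ∫ y : E, kernelProfile y with hk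
  have hkd : Differentiable ℝ k :=
    (contDiff_kernelProfile.div_const _).differentiable two_ne_zero
  have h1 : ∀ z, ‖fderiv ℝ (mollifier ε : E → ℝ) z‖ =
      (ε ^ Module.finrank ℝ E)⁻¹ * ε⁻¹ * ‖fderiv ℝ k (ε⁻¹ • z)‖ := by
    intro z
    have hs : HasFDerivAt (fun z : E => ε⁻¹ • z) (ε⁻¹ • ContinuousLinearMap.id ℝ E) z :=
      (hasFDerivAt_id z).const_smul _
    have := ((hkd (ε⁻¹ • z)).hasFDerivAt.comp z hs).const_mul (ε ^ Module.finrank ℝ E)⁻¹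
    have h2 : fderiv ℝ (mollifier ε : E → ℝ) z = _ := this.fderiv
    rw [h2]
    simp [norm_smul, abs_of_pos hε, mul_assoc]
  rw [integral_sub_left_eq_self (fun z => ‖fderiv ℝ (mollifier ε : E → ℝ) z‖) volume x]
  simp only [h1]
  rw [integral_const_mul, Measure.integral_comp_inv_smul_of_nonneg volume
    (fun z : E => ‖fderiv ℝ k z‖) hε.le, smul_eq_mul]
  have : ε * ((ε ^ Module.finrank ℝ E)⁻¹ * ε⁻¹ * (ε ^ Module.finrank ℝ E *
      ∫ z, ‖fderiv ℝ k z‖)) = ∫ z, ‖fderiv ℝ k z‖ := by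
    field_simp
  rw [this]
  linarith

end Kernel

/-! ### Mollification and its pointwise error bounds. -/

section Mollify

variable {E : Type*} [NormedAddCommGroup E] [InnerProductSpace ℝ E] [FiniteDimensional ℝ E]
  [MeasureSpace E] [BorelSpace E] [(volume : Measure E).IsAddHaarMeasure]
  {F : Type*} [NormedAddCommGroup F] [NormedSpace ℝ F]

/-- The mollification of `f` at scale `ε`. -/
noncomputable def mollify (ε : ℝ) (f : E → F) (x : E) : F := ∫ y, mollifier ε (x - y) • f y

theorem integrable_mollifier_smul {ε : ℝ} (hε : 0 < ε) {f : E → F} (hf : LocallyIntegrable f)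
    (x : E) : Integrable fun y => mollifier ε (x - y) • f y :=
  integrable_kernel_smul (contDiff_mollifier ε).continuous (hasCompactSupport_mollifier hε) hf x

theorem integrable_mollifier_sub_left {ε : ℝ} (hε : 0 < ε) (x : E) :
    Integrable fun y : E => mollifier ε (x - y) := by
  simpa using integrable_mollifier_smul hε (f := fun _ : E => (1 : ℝ))
    (continuous_const.locallyIntegrable) x

theorem contDiff_mollify {ε : ℝ} (hε : 0 < ε) {f : E → ℝ} (hf : LocallyIntegrable f) :
    ContDiff ℝ 2 (mollify ε f) := by
  exact_mod_cast contDiff_integral_kernel (m := 2) (contDiff_mollifier ε)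
    (hasCompactSupport_mollifier hε) hf

variable [CompleteSpace F]

theorem mollify_sub_const {ε : ℝ} (hε : 0 < ε) {f : E → F} (hf : LocallyIntegrable f)
    (x : E) (c : F) : mollify ε f x - c = ∫ y, mollifier ε (x - y) • (f y - c) := by
  have h1 : ∫ y, mollifier ε (x - y) • c = c := by
    rw [integral_smul_const, integral_mollifier_sub_left hε, one_smul]
  simp only [smul_sub]
  rw [integral_sub (integrable_mollifier_smul hε hf x)
    ((integrable_mollifier_sub_left hε x).smul_const c), h1, mollify]

/-- The mollification at `x` is close to `c` if the function is close to `c` almost everywhere near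
`x`. -/
theorem norm_mollify_sub_le {ε : ℝ} (hε : 0 < ε) {f : E → F} (hf : LocallyIntegrable f)
    {x : E} {c : F} {δ : ℝ} (h : ∀ᵐ y, ‖y - x‖ < ε → ‖f y - c‖ ≤ δ) :
    ‖mollify ε f x - c‖ ≤ δ := by
  rw [mollify_sub_const hε hf]
  have h1 : ∫ y, mollifier ε (x - y) * δ = δ := by
    rw [integral_mul_const, integral_mollifier_sub_left hε, one_mul]
  rw [← h1]
  refine norm_integral_le_of_norm_le ((integrable_mollifier_sub_left hε x).mul_const δ) ?_
  filter_upwards [h] with y hy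
  rw [norm_smul, Real.norm_of_nonneg (mollifier_nonneg hε _)]
  by_cases hxy : ‖y - x‖ < ε
  · exact mul_le_mul_of_nonneg_left (hy hxy) (mollifier_nonneg hε _)
  · rw [mollifier_eq_zero hε (by rw [norm_sub_rev]; exact not_lt.1 hxy)]
    simp

theorem norm_mollify_le {ε : ℝ} (hε : 0 < ε) {f : E → F} (hf : LocallyIntegrable f)
    {x : E} {δ : ℝ} (h : ∀ᵐ y, ‖y - x‖ < ε → ‖f y‖ ≤ δ) : ‖mollify ε f x‖ ≤ δ := by
  simpa using norm_mollify_sub_le hε hf (c := 0) (by simpa using h)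

/-- The mollification is controlled by the mean oscillation. -/
theorem exists_norm_mollify_sub_le_average : ∃ C : ℝ, 0 < C ∧ ∀ (f : E → F),
    LocallyIntegrable f → ∀ ε : ℝ, 0 < ε → ∀ (x : E) (c : F),
      ‖mollify ε f x - c‖ ≤ C * ⨍ y in Metric.closedBall x ε, ‖f y - c‖ := by
  obtain ⟨C, hC, h⟩ := exists_mollifier_le (E := E)
  refine ⟨C, hC, fun f hf ε hε x c => ?_⟩
  have hint : IntegrableOn (fun y => ‖f y - c‖) (Metric.closedBall x ε) :=
    ((hf.sub (continuous_const.locallyIntegrable (f := fun _ : E => c))).integrableOn_isCompact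
      (isCompact_closedBall x ε)).norm
  rw [mollify_sub_const hε hf, setAverage_eq, smul_eq_mul, ← integral_indicator
    measurableSet_closedBall, ← mul_assoc, ← integral_const_mul]
  refine norm_integral_le_of_norm_le ((hint.integrable_indicator
    measurableSet_closedBall).const_mul _) (Filter.Eventually.of_forall fun y => ?_)
  rw [norm_smul, Real.norm_of_nonneg (mollifier_nonneg hε _)]
  by_cases hxy : y ∈ Metric.closedBall x ε
  · rw [Set.indicator_of_mem hxy]
    exact mul_le_mul_of_nonneg_right ((h ε hε x _).trans_eq (div_eq_mul_inv _ _)) (norm_nonneg _)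
  · rw [mollifier_eq_zero hε, Set.indicator_of_notMem hxy]
    · simp
    · rw [norm_sub_rev, ← dist_eq_norm]
      simpa using (not_le.1 fun h' => hxy h').le

end Mollify

/-! ### Weak derivatives tested against mollifiers. -/

section Weak

variable {n : ℕ} {a w g : EuclideanSpace ℝ (Fin n) → ℝ}
  {G : EuclideanSpace ℝ (Fin n) → EuclideanSpace ℝ (Fin n)}

theorem IsWeakGradient.integral_mul_fderiv (hG : IsWeakGradient w G) (hw : Continuous w)
    {φ : EuclideanSpace ℝ (Fin n) → ℝ} (hφ : ContDiff ℝ 1 φ) (hc : HasCompactSupport φ)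
    (v : EuclideanSpace ℝ (Fin n)) :
    ∫ x, w x * fderiv ℝ φ x v = -∫ x, φ x * inner ℝ (G x) v := by
  have hcg : HasCompactSupport (∇ φ) :=
    (hc.fderiv ℝ).comp_left (g := (InnerProductSpace.toDual ℝ _).symm) (map_zero _)
  have h1 : Integrable fun x => w x • ∇ φ x :=
    (hw.smul (continuous_gradient hφ)).integrable_of_hasCompactSupport hcg.smul_left
  have h2 : Integrable fun x => φ x • G x :=
    integrable_smul_of_hasCompactSupport hφ.continuous hc hG.1
  have h := congrArg (fun z => inner ℝ z v) (hG.2 φ hφ hc)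
  simp only [inner_neg_left] at h
  rw [real_inner_comm, ← integral_inner h1, real_inner_comm, ← integral_inner h2] at h
  simp only [inner_smul_right] at h
  simp only [real_inner_comm v] at h ⊢
  simpa only [real_inner_comm v, inner_gradient_right, conj_trivial] using h

/-- One derivative moves onto `w`, so the commutator below involves only first derivatives of `a`
and of the kernel. -/
theorem IsWeakGradient.integral_mul_laplacian (hG : IsWeakGradient w G) (hw : Continuous w)
    {φ : EuclideanSpace ℝ (Fin n) → ℝ} (hφ : ContDiff ℝ 2 φ) (hc : HasCompactSupport φ) :
    ∫ x, w x * Laplacian.laplacian φ x = -∫ x, fderiv ℝ φ x (G x) := by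
  set b := stdOrthonormalBasis ℝ (EuclideanSpace ℝ (Fin n))
  have h1 : ∀ i, ∫ x, w x * fderiv ℝ (fun z => fderiv ℝ φ z (b i)) x (b i) =
      -∫ x, fderiv ℝ φ x (b i) * inner ℝ (G x) (b i) := fun i =>
    hG.integral_mul_fderiv hw (contDiff_fderiv_apply hφ _) (hasCompactSupport_fderiv_apply hc _) _
  have h2 : ∀ x, fderiv ℝ φ x (G x) = ∑ i, fderiv ℝ φ x (b i) * inner ℝ (G x) (b i) := by
    intro x
    conv_lhs => rw [← b.sum_repr' (G x)]
    simp [real_inner_comm, mul_comm]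
  simp only [laplacian_eq_sum_fderiv hφ, h2, Finset.mul_sum]
  rw [integral_finsetSum, integral_finsetSum, ← Finset.sum_neg_distrib]
  · exact Finset.sum_congr rfl fun i _ => h1 i
  · intro i _
    have := integrable_smul_of_hasCompactSupport (contDiff_fderiv_apply hφ (b i)).continuous
      (hasCompactSupport_fderiv_apply hc (b i)) hG.1
    simpa [inner_smul_left] using this.inner_const (𝕜 := ℝ) (b i)
  · intro i _
    have hcs := hasCompactSupport_fderiv_apply (hasCompactSupport_fderiv_apply hc (b i)) (b i)
    exact (hw.mul (((contDiff_fderiv_apply hφ (b i)).continuous_fderiv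
      one_ne_zero).clm_apply continuous_const)).integrable_of_hasCompactSupport hcs.mul_left

theorem contDiff_mollifier_sub_left (ε : ℝ) (x : EuclideanSpace ℝ (Fin n)) :
    ContDiff ℝ 2 fun y => mollifier ε (x - y) :=
  (contDiff_mollifier ε).comp (contDiff_const.sub contDiff_id)

theorem gradient_mollify (hG : IsWeakGradient w G) (hw : Continuous w) {ε : ℝ} (hε : 0 < ε)
    (x : EuclideanSpace ℝ (Fin n)) : ∇ (mollify ε w) x = mollify ε G x := by
  refine ext_inner_right ℝ fun v => ?_
  have h1 := hG.integral_mul_fderiv hw ((contDiff_mollifier_sub_left ε x).of_le one_le_two)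
    (hasCompactSupport_comp_sub_left (hasCompactSupport_mollifier hε) x) v
  have h2 : fderiv ℝ (mollify ε w) x v = _ := fderiv_integral_kernel
    ((contDiff_mollifier ε).of_le one_le_two) (hasCompactSupport_mollifier hε)
    hw.locallyIntegrable x v
  have h3 : inner ℝ (mollify ε G x) v = ∫ y, mollifier ε (x - y) * inner ℝ (G y) v := by
    rw [mollify, real_inner_comm, ← integral_inner (integrable_mollifier_smul hε hG.1 x)]
    simp only [inner_smul_right, real_inner_comm]
  rw [inner_gradient_left, h2, h3]
  simp only [fderiv_comp_sub_left ((contDiff_mollifier ε).of_le one_le_two), mul_neg,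
    integral_neg, neg_inj] at h1
  rw [← h1]
  simp only [smul_eq_mul, mul_comm]

theorem laplacian_mollify (hw : Continuous w) {ε : ℝ} (hε : 0 < ε)
    (x : EuclideanSpace ℝ (Fin n)) : Laplacian.laplacian (mollify ε w) x =
      ∫ y, w y * Laplacian.laplacian (fun y => mollifier ε (x - y)) y := by
  refine (laplacian_integral_kernel (contDiff_mollifier ε) (hasCompactSupport_mollifier hε)
    hw.locallyIntegrable x).trans ?_
  simp only [laplacian_comp_sub_left (contDiff_mollifier ε), smul_eq_mul, mul_comm]

theorem locallyIntegrable_div_max (hg : LocallyIntegrable g) (ha : Continuous a) {α : ℝ}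
    (hα : 0 < α) : LocallyIntegrable fun y => g y / max (a y) α := by
  have hc : Continuous fun y => (max (a y) α)⁻¹ :=
    (ha.max continuous_const).inv₀ fun y => (lt_max_of_lt_right hα).ne'
  have := (locallyIntegrableOn_univ.2 hg).continuousOn_smul isOpen_univ.isLocallyClosed
    hc.continuousOn
  simpa [div_eq_inv_mul] using locallyIntegrableOn_univ.1 this

/-- Where `a` is positive, the Laplacian of the mollification is the mollification of `g / a`. -/
theorem laplacian_mollify_of_le (hg : IsWeakMulLaplacian a w g) (hw : Continuous w)
    (ha : ContDiff ℝ 2 a) {α : ℝ} (hα : 0 < α) {ε : ℝ} (hε : 0 < ε)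
    {x : EuclideanSpace ℝ (Fin n)} (hx : ∀ y, ‖y - x‖ ≤ ε → α ≤ a y) :
    Laplacian.laplacian (mollify ε w) x = mollify ε (fun y => g y / max (a y) α) x := by
  -- Dividing by `a` makes `a φ` the mollifier itself. Zeros of `a` lie outside the support, where
  -- the quotient is `0`.
  set φ : EuclideanSpace ℝ (Fin n) → ℝ := fun y => mollifier ε (x - y) / a y with hφdef
  have hzero : ∀ y, ε ≤ ‖y - x‖ → mollifier ε (x - y) = 0 := fun y hy =>
    mollifier_eq_zero hε (by rwa [norm_sub_rev])
  have hφ : ContDiff ℝ 2 φ := by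
    rw [contDiff_iff_contDiffAt]
    intro y
    by_cases hy : ‖y - x‖ ≤ ε
    · exact (contDiff_mollifier_sub_left ε x).contDiffAt.div ha.contDiffAt
        (hα.trans_le (hx y hy)).ne'
    · have hev : φ =ᶠ[nhds y] fun _ => 0 := by
        have : Continuous fun z => ‖z - x‖ := by fun_prop
        filter_upwards [this.continuousAt.eventually (lt_mem_nhds (not_le.1 hy))] with z hz
        simp [hφdef, hzero z hz.le]
      exact contDiffAt_const.congr_of_eventuallyEq hev
  have hc : HasCompactSupport φ := by
    refine (hasCompactSupport_comp_sub_left (hasCompactSupport_mollifier hε) x).mono ?_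
    intro y hy h0
    exact hy (by simp [hφdef, h0])
  have hmul : (fun y => a y * φ y) = fun y => mollifier ε (x - y) := by
    ext y
    by_cases hy : ‖y - x‖ ≤ ε
    · have := (hα.trans_le (hx y hy)).ne'
      simp only [hφdef]
      field_simp
    · simp [hφdef, hzero y (not_le.1 hy).le]
  have h := hg.2 φ hφ hc
  rw [hmul, ← laplacian_mollify hw hε] at h
  rw [h, mollify]
  congr 1
  ext y
  by_cases hy : ‖y - x‖ ≤ ε
  · rw [max_eq_left (hx y hy)]
    simp only [hφdef, smul_eq_mul]
    ring
  · simp [hφdef, hzero y (not_le.1 hy).le]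

/-- The commutator of the multiplication by `a` with the mollification. -/
theorem mul_laplacian_mollify_sub (hG : IsWeakGradient w G) (hg : IsWeakMulLaplacian a w g)
    (hw : Continuous w) (ha : ContDiff ℝ 2 a) {ε : ℝ} (hε : 0 < ε)
    (x : EuclideanSpace ℝ (Fin n)) :
    a x * Laplacian.laplacian (mollify ε w) x - mollify ε g x =
      -∫ y, fderiv ℝ (fun y => (a x - a y) * mollifier ε (x - y)) y (G y) := by
  set k : EuclideanSpace ℝ (Fin n) → ℝ := fun y => mollifier ε (x - y) with hk
  have hk2 : ContDiff ℝ 2 k := contDiff_mollifier_sub_left ε x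
  have hkc : HasCompactSupport k :=
    hasCompactSupport_comp_sub_left (hasCompactSupport_mollifier hε) x
  have hak : ContDiff ℝ 2 fun y => a y * k y := ha.mul hk2
  have hΦ : ContDiff ℝ 2 fun y => (a x - a y) * k y := (contDiff_const.sub ha).mul hk2
  -- Undoing the integration by parts puts all three terms in the form `∫ w Δ(·)`, where linearity
  -- of the Laplacian finishes.
  rw [← hG.integral_mul_laplacian hw hΦ hkc.mul_left, laplacian_mollify hw hε]
  have h := hg.2 k hk2 hkc
  have h3 : mollify ε g x = ∫ y, g y * k y := by
    simp only [mollify, smul_eq_mul, mul_comm, hk]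
  have hint : ∀ f : EuclideanSpace ℝ (Fin n) → ℝ, ContDiff ℝ 2 f → HasCompactSupport f →
      Integrable fun y => w y * Laplacian.laplacian f y := by
    intro f hf hfc
    have hs : HasCompactSupport (Laplacian.laplacian f) := by
      refine HasCompactSupport.intro hfc.isCompact fun y hy => ?_
      have := (InnerProductSpace.laplacian_congr_nhds
        (notMem_tsupport_iff_eventuallyEq.1 hy)).self_of_nhds
      rw [this]
      have := congrFun (InnerProductSpace.laplacian_const (E := EuclideanSpace ℝ (Fin n))
        (c := (0 : ℝ))) y
      exact this
    exact (hw.mul (continuous_laplacian hf)).integrable_of_hasCompactSupport hs.mul_left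
  rw [h3, ← h, ← integral_const_mul, ← integral_sub ((hint k hk2 hkc).const_mul _)
    (hint _ hak hkc.mul_left)]
  congr 1
  ext y
  have e1 : (fun y => (a x - a y) * k y) = (a x • k) - fun y => a y * k y := by
    ext y
    simp [sub_mul]
  rw [e1, ContDiffAt.laplacian_sub (f₁ := a x • k) (hk2.const_smul (a x)).contDiffAt
    hak.contDiffAt,
    InnerProductSpace.laplacian_smul _ hk2.contDiffAt, smul_eq_mul]
  ring

end Weak

/-! ### Second-order accuracy of mollification for `C²` functions. -/

section SmoothMollification

variable {E : Type*} [NormedAddCommGroup E] [InnerProductSpace ℝ E] [FiniteDimensional ℝ E]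
  [MeasureSpace E] [BorelSpace E] [(volume : Measure E).IsAddHaarMeasure]

theorem fderiv_mollifier_eq_zero {ε : ℝ} (hε : 0 < ε) {z : E} (hz : ε ≤ ‖z‖) :
    fderiv ℝ (mollifier ε) z = 0 :=
  IsLocalMin.fderiv_eq_zero <| Filter.Eventually.of_forall fun y => by
    rw [mollifier_eq_zero hε hz]
    exact mollifier_nonneg hε y

theorem integrable_norm_fderiv_mollifier {ε : ℝ} (hε : 0 < ε) (x : E) :
    Integrable fun y => ‖fderiv ℝ (mollifier ε) (x - y)‖ := by
  have hk : ContDiff ℝ 1 (mollifier ε : E → ℝ) := (contDiff_mollifier ε).of_le one_le_two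
  have hcont : Continuous fun z => ‖fderiv ℝ (mollifier ε : E → ℝ) z‖ :=
    (hk.continuous_fderiv one_ne_zero).norm
  have hcs : HasCompactSupport fun z => ‖fderiv ℝ (mollifier ε : E → ℝ) z‖ :=
    hasCompactSupport_of_eq_zero fun z hz => by rw [fderiv_mollifier_eq_zero hε hz, norm_zero]
  have h := integrable_kernel_smul hcont hcs (f := fun _ : E => (1 : ℝ))
    continuous_const.locallyIntegrable x
  simpa only [smul_eq_mul, mul_one] using h

theorem abs_integral_apply_le {G : E → E} {K : ℝ} (hK : ∀ᵐ y, ‖G y‖ ≤ K) (hK0 : 0 ≤ K)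
    {L : E → E →L[ℝ] ℝ} {b : E → ℝ} (hb : ∀ y, ‖L y‖ ≤ b y) (hbi : Integrable b) :
    |∫ y, L y (G y)| ≤ K * ∫ y, b y := by
  rw [← integral_const_mul, ← Real.norm_eq_abs]
  refine norm_integral_le_of_norm_le (hbi.const_mul K) ?_
  filter_upwards [hK] with y hy
  refine ((L y).le_opNorm (G y)).trans ?_
  rw [mul_comm]
  exact mul_le_mul hy (hb y) (norm_nonneg _) hK0

/-- Rescaling moves `ε` from the kernel into the argument of `u`, so that one can differentiate in
`ε`, down to `ε = 0`. -/
theorem mollify_eq_integral_kernelProfile {ε : ℝ} (hε : 0 < ε) (u : E → ℝ) (x : E) :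
    (∫ y : E, kernelProfile y) * mollify ε u x = ∫ y, u (x - ε • y) * kernelProfile y := by
  have hm := (integral_kernelProfile_pos (E := E)).ne'
  have h1 := integral_sub_left_eq_self (fun z => mollifier ε z • u (x - z)) volume x
  simp only [sub_sub_cancel] at h1
  have h2 := Measure.integral_comp_inv_smul_of_nonneg (volume : Measure E)
    (fun y => u (x - ε • y) * kernelProfile y) hε.le
  simp only [smul_inv_smul₀ hε.ne'] at h2
  rw [mollify, h1]
  have h3 : ∀ z : E, mollifier ε z • u (x - z) = (ε ^ Module.finrank ℝ E)⁻¹ *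
      (∫ y : E, kernelProfile y)⁻¹ * (u (x - z) * kernelProfile (ε⁻¹ • z)) := fun z => by
    simp only [mollifier, smul_eq_mul]
    ring
  simp only [h3]
  rw [integral_const_mul, h2, smul_eq_mul]
  field_simp

theorem hasDerivAt_integral_kernelProfile {u : E → ℝ} (hu : ContDiff ℝ 1 u) (x : E) (s : ℝ) :
    HasDerivAt (fun s : ℝ => ∫ y, u (x - s • y) * kernelProfile y)
      (∫ y, -fderiv ℝ u (x - s • y) y * kernelProfile y) s := by
  have hP : Continuous (kernelProfile : E → ℝ) := contDiff_kernelProfile.continuous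
  have hPc : HasCompactSupport (kernelProfile : E → ℝ) :=
    hasCompactSupport_of_eq_zero fun _ => kernelProfile_eq_zero
  have hcont : ∀ t : ℝ, Continuous fun y => u (x - t • y) * kernelProfile y := fun t =>
    (hu.continuous.comp (by fun_prop)).mul hP
  have hdu : Continuous (fderiv ℝ u) := hu.continuous_fderiv one_ne_zero
  obtain ⟨D, hD⟩ := (isCompact_closedBall x (|s| + 1)).exists_bound_of_continuousOn
    hdu.continuousOn
  have hdcont : Continuous fun y => -fderiv ℝ u (x - s • y) y * kernelProfile y :=
    ((hdu.comp (by fun_prop)).clm_apply continuous_id).neg.mul hP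
  refine (hasDerivAt_integral_of_dominated_loc_of_deriv_le
    (s := Metric.ball s 1) (bound := fun y => D * kernelProfile y)
    (F' := fun t y => -fderiv ℝ u (x - t • y) y * kernelProfile y)
    (Metric.ball_mem_nhds s one_pos)
    (Filter.Eventually.of_forall fun t => (hcont t).aestronglyMeasurable)
    ((hcont s).integrable_of_hasCompactSupport hPc.mul_left) hdcont.aestronglyMeasurable
    (Filter.Eventually.of_forall fun y t ht => ?_)
    ((hP.integrable_of_hasCompactSupport hPc).const_mul D)
    (Filter.Eventually.of_forall fun y t _ => ?_)).2
  · rw [norm_mul, norm_neg, Real.norm_of_nonneg (kernelProfile_nonneg y)]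
    by_cases hy : 1 ≤ ‖y‖
    · simp [kernelProfile_eq_zero hy]
    refine mul_le_mul_of_nonneg_right ?_ (kernelProfile_nonneg y)
    have hy' : ‖y‖ ≤ 1 := (not_le.1 hy).le
    have ht' : |t| ≤ |s| + 1 := by
      have h1 : |t - s| < 1 := by simpa [Real.dist_eq] using ht
      have h2 := abs_sub_abs_le_abs_sub t s
      linarith
    have hmem : x - t • y ∈ Metric.closedBall x (|s| + 1) := by
      rw [mem_closedBall_iff_norm, sub_sub_cancel_left, norm_neg, norm_smul, Real.norm_eq_abs]
      exact (mul_le_of_le_one_right (abs_nonneg t) hy').trans ht'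
    calc ‖fderiv ℝ u (x - t • y) y‖ ≤ ‖fderiv ℝ u (x - t • y)‖ * ‖y‖ :=
          ContinuousLinearMap.le_opNorm _ _
      _ ≤ ‖fderiv ℝ u (x - t • y)‖ := mul_le_of_le_one_right (norm_nonneg _) hy'
      _ ≤ D := hD _ hmem
  · have hline : HasDerivAt (fun t : ℝ => x - t • y) (-y) t := by
      simpa using ((hasDerivAt_id t).smul_const y).const_sub x
    have := ((hu.differentiable one_ne_zero _).hasFDerivAt.comp_hasDerivAt t hline).mul_const
      (kernelProfile y)
    simpa using this

/-- Since `kernelProfile y • y` is minus the gradient of `kernelPotential`, integrating by parts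
leaves only the Laplacian of `u`, with a factor `s`. This is where radiality of the kernel matters.
-/
theorem integral_fderiv_mul_kernelProfile {u : E → ℝ} (hu : ContDiff ℝ 2 u) (x : E) (s : ℝ) :
    ∫ y, -fderiv ℝ u (x - s • y) y * kernelProfile y =
      s * ∫ y, Laplacian.laplacian u (x - s • y) * kernelPotential y := by
  set b := stdOrthonormalBasis ℝ E
  have hψ : ContDiff ℝ 2 (kernelPotential : E → ℝ) := contDiff_kernelPotential
  have hψc : HasCompactSupport (kernelPotential : E → ℝ) :=
    hasCompactSupport_of_eq_zero fun _ => kernelPotential_eq_zero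
  have hd : ∀ i, ContDiff ℝ 1 fun y => fderiv ℝ u (x - s • y) (b i) := fun i =>
    (contDiff_fderiv_apply hu (b i)).comp (contDiff_const.sub (contDiff_const_smul s))
  have hdd : ∀ i y, fderiv ℝ (fun y => fderiv ℝ u (x - s • y) (b i)) y (b i) =
      -s * fderiv ℝ (fun z => fderiv ℝ u z (b i)) (x - s • y) (b i) := by
    intro i y
    have hl : HasFDerivAt (fun y : E => x - s • y) (-(s • ContinuousLinearMap.id ℝ E)) y :=
      ((hasFDerivAt_id y).const_smul s).const_sub x
    have := (((contDiff_fderiv_apply hu (b i)).differentiable one_ne_zero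
      (x - s • y)).hasFDerivAt).comp y hl
    refine (congrArg (fun L => L (b i)) this.fderiv).trans ?_
    simp
  have hpt : ∀ y, -fderiv ℝ u (x - s • y) y * kernelProfile y =
      ∑ i, fderiv ℝ u (x - s • y) (b i) * fderiv ℝ kernelPotential y (b i) := by
    intro y
    have : fderiv ℝ u (x - s • y) y = ∑ i, inner ℝ y (b i) * fderiv ℝ u (x - s • y) (b i) := by
      have hL : ∀ L : E →L[ℝ] ℝ, L y = ∑ i, inner ℝ y (b i) * L (b i) := fun L => by
        conv_lhs => rw [← b.sum_repr' y, map_sum]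
        simp [real_inner_comm]
      exact hL _
    rw [this, neg_mul, Finset.sum_mul, ← Finset.sum_neg_distrib]
    refine Finset.sum_congr rfl fun i _ => ?_
    rw [fderiv_kernelPotential]
    ring
  have hdψ : ∀ i, Continuous fun y => fderiv ℝ kernelPotential y (b i) := fun i =>
    (contDiff_fderiv_apply hψ (b i)).continuous
  have hddc : ∀ i, Continuous fun y =>
      fderiv ℝ (fun y => fderiv ℝ u (x - s • y) (b i)) y (b i) := fun i =>
    ((hd i).continuous_fderiv one_ne_zero).clm_apply continuous_const
  have hI1 : ∀ i, Integrable fun y =>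
      fderiv ℝ u (x - s • y) (b i) * fderiv ℝ kernelPotential y (b i) := fun i =>
    ((hd i).continuous.mul (hdψ i)).integrable_of_hasCompactSupport
      (hasCompactSupport_fderiv_apply hψc _).mul_left
  have hI2 : ∀ i, Integrable fun y =>
      fderiv ℝ (fun y => fderiv ℝ u (x - s • y) (b i)) y (b i) * kernelPotential y := fun i =>
    ((hddc i).mul hψ.continuous).integrable_of_hasCompactSupport hψc.mul_left
  simp only [hpt]
  rw [integral_finsetSum _ fun i _ => hI1 i]
  have hibp : ∀ i, ∫ y, fderiv ℝ u (x - s • y) (b i) * fderiv ℝ kernelPotential y (b i) =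
      -∫ y, fderiv ℝ (fun y => fderiv ℝ u (x - s • y) (b i)) y (b i) * kernelPotential y :=
    fun i => integral_mul_fderiv_eq_neg_fderiv_mul_of_integrable (hI2 i) (hI1 i)
      (((hd i).continuous.mul hψ.continuous).integrable_of_hasCompactSupport hψc.mul_left)
      (fun y _ => (hd i).differentiable one_ne_zero y)
      (fun y _ => hψ.differentiable two_ne_zero y)
  simp only [hibp]
  rw [Finset.sum_neg_distrib, ← integral_finsetSum _ fun i _ => hI2 i, ← integral_const_mul,
    ← integral_neg]
  congr 1
  ext y
  rw [laplacian_eq_sum_fderiv hu, ← Finset.sum_mul]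
  simp only [hdd]
  rw [← Finset.mul_sum]
  ring

variable (E) in
-- The scale derivative at `s ≤ ε` is at most `ε B ∫ kernelPotential`; the mean value inequality on
-- `[0, ε]` supplies the second factor `ε`.
theorem exists_abs_mollify_sub_le_of_laplacian_le : ∃ C : ℝ, 0 < C ∧ ∀ (u : E → ℝ),
    ContDiff ℝ 2 u → ∀ (x : E) (ε B : ℝ), 0 < ε → 0 ≤ B →
      (∀ z, ‖z - x‖ ≤ ε → |Laplacian.laplacian u z| ≤ B) →
        |mollify ε u x - u x| ≤ C * B * ε ^ 2 := by
  have hm := integral_kernelProfile_pos (E := E)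
  have hψ : Continuous (kernelPotential : E → ℝ) := contDiff_kernelPotential.continuous
  have hψc : HasCompactSupport (kernelPotential : E → ℝ) :=
    hasCompactSupport_of_eq_zero fun _ => kernelPotential_eq_zero
  have hψpos : 0 < ∫ y : E, kernelPotential y :=
    hψ.integral_pos_of_hasCompactSupport_nonneg_nonzero hψc kernelPotential_nonneg
      (x := 0) (by simp [kernelPotential, (expNegInvGlue.pos_of_pos one_pos).ne'])
  refine ⟨(∫ y : E, kernelPotential y) / ∫ y : E, kernelProfile y, div_pos hψpos hm,
    fun u hu x ε B hε hB hΔ => ?_⟩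
  set Φ : ℝ → ℝ := fun s => ∫ y, u (x - s • y) * kernelProfile y
  have hder : ∀ s ∈ Set.Icc 0 ε, HasDerivWithinAt Φ
      (s * ∫ y, Laplacian.laplacian u (x - s • y) * kernelPotential y) (Set.Icc 0 ε) s := by
    intro s _
    rw [← integral_fderiv_mul_kernelProfile hu]
    exact (hasDerivAt_integral_kernelProfile (hu.of_le one_le_two) x s).hasDerivWithinAt
  have hbound : ∀ s ∈ Set.Ico 0 ε,
      ‖s * ∫ y, Laplacian.laplacian u (x - s • y) * kernelPotential y‖ ≤
        ε * (B * ∫ y : E, kernelPotential y) := by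
    intro s hs
    rw [norm_mul, Real.norm_of_nonneg hs.1]
    refine mul_le_mul hs.2.le ?_ (norm_nonneg _) hε.le
    rw [← integral_const_mul]
    refine norm_integral_le_of_norm_le ((hψ.integrable_of_hasCompactSupport hψc).const_mul B)
      (Filter.Eventually.of_forall fun y => ?_)
    rw [norm_mul, Real.norm_of_nonneg (kernelPotential_nonneg y)]
    by_cases hy : 1 ≤ ‖y‖
    · simp [kernelPotential_eq_zero hy]
    refine mul_le_mul_of_nonneg_right (hΔ _ ?_) (kernelPotential_nonneg y)
    rw [sub_sub_cancel_left, norm_neg, norm_smul, Real.norm_of_nonneg hs.1]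
    exact (mul_le_of_le_one_right hs.1 (not_le.1 hy).le).trans hs.2.le
  have h := norm_image_sub_le_of_norm_deriv_le_segment' hder hbound ε (Set.right_mem_Icc.2 hε.le)
  have h0 : Φ 0 = (∫ y : E, kernelProfile y) * u x := by
    simp [Φ, integral_const_mul, mul_comm]
  have hε' : Φ ε = (∫ y : E, kernelProfile y) * mollify ε u x :=
    (mollify_eq_integral_kernelProfile hε u x).symm
  rw [h0, hε', ← mul_sub, norm_mul, Real.norm_of_nonneg hm.le, Real.norm_eq_abs, sub_zero] at h
  rw [div_mul_eq_mul_div, div_mul_eq_mul_div, le_div_iff₀ hm]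
  linarith

end SmoothMollification

/-! ### Distance from `w` to its mollification. -/

section Estimates

variable {n : ℕ} {a w g : EuclideanSpace ℝ (Fin n) → ℝ}
  {G : EuclideanSpace ℝ (Fin n) → EuclideanSpace ℝ (Fin n)} {K M : ℝ}

theorem tendsto_mollify (hw : Continuous w) (x : EuclideanSpace ℝ (Fin n)) :
    Filter.Tendsto (fun ε => mollify ε w x) (nhdsWithin 0 (Set.Ioi 0)) (nhds (w x)) := by
  rw [Metric.tendsto_nhds]
  intro δ hδ
  obtain ⟨r, hr, h⟩ := Metric.continuous_iff.1 hw x (δ / 2) (half_pos hδ)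
  filter_upwards [Ioo_mem_nhdsGT hr] with ε hε
  rw [dist_eq_norm]
  refine (norm_mollify_sub_le hε.1 hw.locallyIntegrable (δ := δ / 2)
    (Filter.Eventually.of_forall fun y hy => ?_)).trans_lt (half_lt_self hδ)
  rw [← dist_eq_norm]
  exact (h y (by rw [dist_eq_norm]; exact hy.trans hε.2)).le

/-- Each mollification has gradient bounded by `K`, hence is `K`-Lipschitz, and the bound survives
the limit `ε → 0`. -/
theorem IsWeakGradient.abs_sub_le (hG : IsWeakGradient w G) (hw : Continuous w)
    (hK : ∀ᵐ y, ‖G y‖ ≤ K) (x y : EuclideanSpace ℝ (Fin n)) : |w x - w y| ≤ K * ‖x - y‖ := by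
  have h : ∀ᶠ ε in nhdsWithin (0 : ℝ) (Set.Ioi 0),
      |mollify ε w x - mollify ε w y| ≤ K * ‖x - y‖ := by
    filter_upwards [self_mem_nhdsWithin] with ε hε
    refine Convex.norm_image_sub_le_of_norm_fderiv_le (𝕜 := ℝ) (s := Set.univ)
      (fun z _ => (contDiff_mollify hε hw.locallyIntegrable).differentiable two_ne_zero z)
      (fun z _ => ?_) convex_univ (Set.mem_univ _) (Set.mem_univ _)
    rw [← norm_gradient, gradient_mollify hG hw hε]
    exact norm_mollify_le hε hG.1 (hK.mono fun y hy _ => hy)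
  exact le_of_tendsto ((tendsto_mollify hw x).sub (tendsto_mollify hw y)).abs h

theorem abs_mollify_sub_le (hG : IsWeakGradient w G) (hw : Continuous w)
    (hK : ∀ᵐ y, ‖G y‖ ≤ K) (hK0 : 0 ≤ K) {ε : ℝ} (hε : 0 < ε) (x : EuclideanSpace ℝ (Fin n)) :
    |mollify ε w x - w x| ≤ K * ε :=
  norm_mollify_sub_le hε hw.locallyIntegrable <| Filter.Eventually.of_forall fun y hy =>
    (hG.abs_sub_le hw hK y x).trans (mul_le_mul_of_nonneg_left hy.le hK0)

/-- Where the equation is nondegenerate, mollification is accurate to second order. -/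
theorem exists_abs_mollify_sub_le_sq (hG : IsWeakGradient w G) (hg : IsWeakMulLaplacian a w g)
    (hw : Continuous w) (ha : ContDiff ℝ 2 a) (hK : ∀ᵐ y, ‖G y‖ ≤ K) (hK0 : 0 ≤ K)
    (hM : ∀ᵐ y, |g y| ≤ M) (hM0 : 0 ≤ M) {x₀ : EuclideanSpace ℝ (Fin n)} (hx₀ : 0 < a x₀) :
    ∃ C r : ℝ, 0 < C ∧ 0 < r ∧ ∀ x, ‖x - x₀‖ < r → ∀ ε, 0 < ε → ε < r →
      |mollify ε w x - w x| ≤ C * ε ^ 2 := by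
  obtain ⟨C, hC, hsm⟩ := exists_abs_mollify_sub_le_of_laplacian_le (EuclideanSpace ℝ (Fin n))
  have hα : 0 < a x₀ / 2 := half_pos hx₀
  obtain ⟨r, hr, hball⟩ := Metric.eventually_nhds_iff.1
    (ha.continuous.continuousAt.eventually (lt_mem_nhds (half_lt_self hx₀)))
  refine ⟨2 * K + C * (M / (a x₀ / 2)) + 1, min (r / 4) 1, by positivity, by positivity,
    fun x hx ε hε hεr => ?_⟩
  have hε1 : ε < 1 := hεr.trans_le (min_le_right _ _)
  have hε4 : ε < r / 4 := hεr.trans_le (min_le_left _ _)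
  -- `w` need not be `C²`, so the smooth estimate is applied to its mollification at scale `ε²`.
  -- Replacing `w` by that function costs `K ε²` twice, hence the `2 * K` in the constant.
  have hη : 0 < ε ^ 2 := by positivity
  have hηε : ε ^ 2 ≤ ε := by nlinarith
  have hΔ : ∀ z, ‖z - x‖ ≤ ε → |Laplacian.laplacian (mollify (ε ^ 2) w) z| ≤ M / (a x₀ / 2) := by
    intro z hz
    rw [laplacian_mollify_of_le hg hw ha hα hη]
    · refine norm_mollify_le hη (locallyIntegrable_div_max hg.1 ha.continuous hα) ?_
      filter_upwards [hM] with y hy _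
      rw [norm_div, Real.norm_of_nonneg (hα.le.trans (le_max_right _ _))]
      exact div_le_div₀ hM0 hy hα (le_max_right _ _)
    · intro y hy
      refine (hball ?_).le
      rw [dist_eq_norm]
      have h1 := norm_sub_le_norm_sub_add_norm_sub y z x₀
      have h2 := norm_sub_le_norm_sub_add_norm_sub z x x₀
      have h3 : ‖x - x₀‖ < r / 4 := hx.trans_le (min_le_left _ _)
      linarith
  have h1 := hsm _ (contDiff_mollify hη hw.locallyIntegrable) x ε _ hε (by positivity) hΔ
  have h2 := abs_mollify_sub_le hG hw hK hK0 hη x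
  have h3 : |mollify ε (mollify (ε ^ 2) w) x - mollify ε w x| ≤ K * ε ^ 2 := by
    have hsub : mollify ε (mollify (ε ^ 2) w) x - mollify ε w x =
        mollify ε (fun y => mollify (ε ^ 2) w y - w y) x := by
      simp only [mollify, smul_sub]
      exact (integral_sub (integrable_mollifier_smul hε
        (contDiff_mollify hη hw.locallyIntegrable).continuous.locallyIntegrable x)
        (integrable_mollifier_smul hε hw.locallyIntegrable x)).symm
    rw [hsub]
    exact norm_mollify_le hε ((contDiff_mollify hη hw.locallyIntegrable).continuous.sub
      hw).locallyIntegrable (Filter.Eventually.of_forall fun y _ =>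
        abs_mollify_sub_le hG hw hK hK0 hη y)
  rw [abs_le] at h1 h2 h3 ⊢
  constructor <;> nlinarith

end Estimates

/-! ### Commutator of mollification with multiplication by `a`. -/

section Commutator

variable {n : ℕ} {a w g : EuclideanSpace ℝ (Fin n) → ℝ}
  {G : EuclideanSpace ℝ (Fin n) → EuclideanSpace ℝ (Fin n)} {K M : ℝ}

/-- Product rule: inside the ball `|a x - a y| ≤ A ε`; outside it the mollifier and its derivative
vanish. -/
theorem norm_fderiv_sub_mul_mollifier_le (ha : ContDiff ℝ 2 a) {x : EuclideanSpace ℝ (Fin n)}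
    {ε A : ℝ} (hε : 0 < ε) (hA : 0 ≤ A) (hAb : ∀ y, ‖y - x‖ < ε → ‖fderiv ℝ a y‖ ≤ A)
    (y : EuclideanSpace ℝ (Fin n)) :
    ‖fderiv ℝ (fun y => (a x - a y) * mollifier ε (x - y)) y‖ ≤
      A * (mollifier ε (x - y) + ε * ‖fderiv ℝ (mollifier ε) (x - y)‖) := by
  have hk : ContDiff ℝ 1 (mollifier ε : EuclideanSpace ℝ (Fin n) → ℝ) :=
    (contDiff_mollifier ε).of_le one_le_two
  have hda : HasFDerivAt (fun y => a x - a y) (-fderiv ℝ a y) y :=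
    ((ha.differentiable two_ne_zero y).hasFDerivAt).const_sub _
  have hdk : HasFDerivAt (fun y => mollifier ε (x - y))
      (-fderiv ℝ (mollifier ε) (x - y)) y := by
    have := ((hk.differentiable one_ne_zero (x - y)).hasFDerivAt).comp y
      ((hasFDerivAt_id y).const_sub x)
    simpa [Function.comp_def] using this
  rw [(hda.fun_mul hdk).fderiv]
  by_cases hxy : ‖y - x‖ < ε
  · have hmv : |a x - a y| ≤ A * ε := by
      have h1 := (convex_ball x ε).norm_image_sub_le_of_norm_fderiv_le (𝕜 := ℝ) (f := a) (x := y)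
        (y := x) (C := A) (fun z _ => ha.differentiable two_ne_zero z)
        (fun z hz => hAb z (by simpa [dist_eq_norm] using hz))
        (by simpa [dist_eq_norm] using hxy) (Metric.mem_ball_self hε)
      refine h1.trans (mul_le_mul_of_nonneg_left ?_ hA)
      rw [norm_sub_rev]
      exact hxy.le
    refine (norm_add_le _ _).trans ?_
    rw [norm_smul, norm_smul, norm_neg, norm_neg, Real.norm_eq_abs,
      Real.norm_of_nonneg (mollifier_nonneg hε _), mul_add, add_comm, mul_comm A]
    refine add_le_add (mul_le_mul_of_nonneg_left (hAb y hxy) (mollifier_nonneg hε _)) ?_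
    rw [← mul_assoc]
    exact mul_le_mul_of_nonneg_right hmv (norm_nonneg _)
  · have h : ε ≤ ‖x - y‖ := by rw [norm_sub_rev]; exact not_lt.1 hxy
    simp [mollifier_eq_zero hε h, fderiv_mollifier_eq_zero hε h]

/-- The bound is uniform in `ε` but becomes small only where `Da` is small, that is, near zeros of
`a`. -/
theorem exists_abs_commutator_le (hG : IsWeakGradient w G)
    (hg : IsWeakMulLaplacian a w g) (hw : Continuous w) (ha : ContDiff ℝ 2 a)
    (hK : ∀ᵐ y, ‖G y‖ ≤ K) (hK0 : 0 ≤ K) :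
    ∃ C : ℝ, 0 < C ∧ ∀ (x : EuclideanSpace ℝ (Fin n)) (ε A : ℝ), 0 < ε → 0 ≤ A →
      (∀ y, ‖y - x‖ < ε → ‖fderiv ℝ a y‖ ≤ A) →
      |a x * Laplacian.laplacian (mollify ε w) x - mollify ε g x| ≤ C * A := by
  obtain ⟨C, hC, hCb⟩ := integral_norm_fderiv_mollifier (E := EuclideanSpace ℝ (Fin n))
  refine ⟨K * (1 + C) + 1, by positivity, fun x ε A hε hA hAb => ?_⟩
  have hint1 := integrable_mollifier_sub_left hε x
  have hint2 := integrable_norm_fderiv_mollifier hε x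
  rw [mul_laplacian_mollify_sub hG hg hw ha hε, abs_neg]
  refine (abs_integral_apply_le hK hK0 (norm_fderiv_sub_mul_mollifier_le ha hε hA hAb)
    ((hint1.add (hint2.const_mul ε)).const_mul A)).trans ?_
  rw [integral_const_mul, integral_add hint1 (hint2.const_mul ε), integral_const_mul,
    integral_mollifier_sub_left hε]
  calc K * (A * (1 + ε * ∫ y, ‖fderiv ℝ (mollifier ε) (x - y)‖)) ≤ K * (A * (1 + C)) := by
        gcongr
        exact hCb ε hε x
    _ ≤ (K * (1 + C) + 1) * A := by linarith

/-- The mollification of `w` solves the mollified equation up to a locally uniformly small error. -/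
theorem exists_abs_mul_laplacian_mollify_sub_le (hG : IsWeakGradient w G)
    (hg : IsWeakMulLaplacian a w g) (hw : Continuous w) (ha : IsDiffusionCoefficient a)
    (hK : ∀ᵐ y, ‖G y‖ ≤ K) (hK0 : 0 ≤ K) (hM : ∀ᵐ y, |g y| ≤ M) (hM0 : 0 ≤ M)
    (x₀ : EuclideanSpace ℝ (Fin n)) {η : ℝ} (hη : 0 < η) :
    ∃ r : ℝ, 0 < r ∧ ∀ x, ‖x - x₀‖ < r → ∀ ε, 0 < ε → ε < r →
      |a x * Laplacian.laplacian (mollify ε w) x - mollify ε g x| ≤ η := by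
  rcases (ha.nonneg x₀).eq_or_lt with h0 | hpos
  · obtain ⟨C, hC, hb⟩ := exists_abs_commutator_le hG hg hw ha.contDiff hK hK0
    have hmin : IsLocalMin a x₀ := Filter.Eventually.of_forall fun y => by
      rw [← h0]
      exact ha.nonneg y
    have hcont : Continuous fun y => ‖fderiv ℝ a y‖ :=
      (ha.contDiff.continuous_fderiv two_ne_zero).norm
    have hlt : ‖fderiv ℝ a x₀‖ < η / C := by
      rw [hmin.fderiv_eq_zero, norm_zero]
      positivity
    obtain ⟨r, hr, hball⟩ := Metric.eventually_nhds_iff.1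
      (hcont.continuousAt.eventually (gt_mem_nhds hlt))
    refine ⟨r / 2, half_pos hr, fun x hx ε hε hεr => ?_⟩
    refine (hb x ε (η / C) hε (by positivity) fun y hy => (hball ?_).le).trans_eq (by field_simp)
    rw [dist_eq_norm]
    have := norm_sub_le_norm_sub_add_norm_sub y x x₀
    linarith
  · set α := a x₀ / 2 with hαdef
    have hα : 0 < α := half_pos hpos
    -- Here the commutator is the average of `(a x - a y) g / a`; an oscillation `β` of `a` makes it
    -- at most `β (M + 1) / α = η`.
    set β := α * η / (M + 1) with hβdef
    have hβ : 0 < β := by positivity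
    obtain ⟨r, hr, hball⟩ := Metric.eventually_nhds_iff.1
      ((ha.contDiff.continuous.continuousAt.eventually (lt_mem_nhds (half_lt_self hpos))).and
        (ha.contDiff.continuous.continuousAt.eventually (Metric.ball_mem_nhds _ (half_pos hβ))))
    refine ⟨r / 2, half_pos hr, fun x hx ε hε hεr => ?_⟩
    have hnear : ∀ y, ‖y - x‖ ≤ ε → dist y x₀ < r := fun y hy => by
      rw [dist_eq_norm]
      have := norm_sub_le_norm_sub_add_norm_sub y x x₀
      linarith
    have hloc := locallyIntegrable_div_max hg.1 ha.contDiff.continuous hα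
    have hx' : dist x x₀ < r := hnear x (by simpa using hε.le)
    rw [laplacian_mollify_of_le hg hw ha.contDiff hα hε fun y hy => (hball (hnear y hy)).1.le]
    have heq : a x * mollify ε (fun y => g y / max (a y) α) x - mollify ε g x =
        mollify ε (fun y => a x * (g y / max (a y) α) - g y) x := by
      simp only [mollify, smul_sub]
      rw [integral_sub _ (integrable_mollifier_smul hε hg.1 x), ← integral_const_mul]
      · simp only [smul_eq_mul, mul_left_comm]
      · simpa only [smul_eq_mul, mul_left_comm] using
          (integrable_mollifier_smul hε hloc x).const_mul (a x)
    rw [heq]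
    have hloc2 : LocallyIntegrable fun y => a x * (g y / max (a y) α) - g y := by
      have := (hloc.smul (a x)).sub hg.1
      exact this
    refine norm_mollify_le hε hloc2 ?_
    filter_upwards [hM] with y hy hyx
    have hay := hball (hnear y hyx.le)
    have hax := hball hx'
    have hay0 : 0 < a y := hα.trans hay.1
    rw [max_eq_left hay.1.le]
    have e1 : a x * (g y / a y) - g y = (a x - a y) * g y / a y := by
      field_simp
    have h1 : |a x - a y| ≤ β := by
      have h2 := hay.2
      have h3 := hax.2
      rw [Real.dist_eq] at h2 h3
      rw [abs_lt] at h2 h3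
      rw [abs_le]
      constructor <;> linarith
    rw [e1, Real.norm_eq_abs, abs_div, abs_mul, abs_of_pos hay0, div_le_iff₀ hay0]
    calc |a x - a y| * |g y| ≤ β * (M + 1) :=
          mul_le_mul h1 (by linarith) (abs_nonneg _) hβ.le
      _ = η * α := by rw [hβdef]; field_simp
      _ ≤ η * a y := mul_le_mul_of_nonneg_left hay.1.le hη.le

end Commutator

/-! ### The two implications. -/

section Equivalence

variable {n : ℕ} {H : EuclideanSpace ℝ (Fin n) → EuclideanSpace ℝ (Fin n) → ℝ}
  {a w g : EuclideanSpace ℝ (Fin n) → ℝ}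
  {G : EuclideanSpace ℝ (Fin n) → EuclideanSpace ℝ (Fin n)} {K M : ℝ}

theorem IsHamiltonian.continuous (hH : IsHamiltonian H) :
    Continuous fun z : EuclideanSpace ℝ (Fin n) × EuclideanSpace ℝ (Fin n) => H z.1 z.2 :=
  hH.contDiff.continuous

theorem IsHamiltonian.differentiable (hH : IsHamiltonian H) (x : EuclideanSpace ℝ (Fin n)) :
    Differentiable ℝ (H x) :=
  (hH.contDiff.comp (contDiff_const.prodMk contDiff_id)).differentiable two_ne_zero

theorem IsHamiltonian.exists_le_add (hH : IsHamiltonian H) (x₀ : EuclideanSpace ℝ (Fin n)) (K : ℝ)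
    {η : ℝ} (hη : 0 < η) : ∃ r : ℝ, 0 < r ∧ ∀ x y p, ‖x - x₀‖ < r → ‖y - x₀‖ < r → ‖p‖ ≤ K →
      H x p ≤ H y p + η := by
  have huc := ((isCompact_closedBall x₀ 1).prod
    (isCompact_closedBall (0 : EuclideanSpace ℝ (Fin n)) K)).uniformContinuousOn_of_continuous
    hH.continuous.continuousOn
  obtain ⟨δ, hδ, h⟩ := Metric.uniformContinuousOn_iff.1 huc η hη
  refine ⟨min 1 (δ / 2), by positivity, fun x y p hx hy hp => ?_⟩
  have hp' : p ∈ Metric.closedBall (0 : EuclideanSpace ℝ (Fin n)) K := by simpa using hp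
  have hmem : ∀ z, ‖z - x₀‖ < min 1 (δ / 2) → z ∈ Metric.closedBall x₀ 1 := fun z hz => by
    rw [mem_closedBall_iff_norm]
    exact (hz.trans_le (min_le_left _ _)).le
  have hd : dist x y < δ := by
    have h1 := dist_triangle_right x y x₀
    rw [dist_eq_norm x x₀, dist_eq_norm y x₀] at h1
    have h2 := hx.trans_le (min_le_right _ _)
    have h3 := hy.trans_le (min_le_right _ _)
    linarith
  have := h (x, p) ⟨hmem x hx, hp'⟩ (y, p) ⟨hmem y hy, hp'⟩ (by
    rw [Prod.dist_eq, dist_self]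
    exact max_lt hd hδ)
  rw [Real.dist_eq] at this
  linarith [(abs_lt.1 this).2]

/-- Mollifying an almost everywhere subsolution gives a classical subsolution up to a small
error. -/
theorem exists_mollify_subsolution (hH : IsHamiltonian H) (hG : IsWeakGradient w G)
    (hg : IsWeakMulLaplacian a w g) (hw : Continuous w) (ha : IsDiffusionCoefficient a)
    (hK : ∀ᵐ y, ‖G y‖ ≤ K) (hK0 : 0 ≤ K) (hM : ∀ᵐ y, |g y| ≤ M) (hM0 : 0 ≤ M)
    (hae : ∀ᵐ y, H y (G y) ≤ g y) (x₀ : EuclideanSpace ℝ (Fin n)) {η : ℝ} (hη : 0 < η) :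
    ∃ r : ℝ, 0 < r ∧ ∀ x, ‖x - x₀‖ < r → ∀ ε, 0 < ε → ε < r →
      H x (∇ (mollify ε w) x) ≤ a x * Laplacian.laplacian (mollify ε w) x + η := by
  obtain ⟨r₁, hr₁, h₁⟩ := exists_abs_mul_laplacian_mollify_sub_le hG hg hw ha hK hK0 hM hM0 x₀
    (half_pos hη)
  obtain ⟨r₂, hr₂, h₂⟩ := hH.exists_le_add x₀ K (half_pos hη)
  refine ⟨min r₁ (r₂ / 2), by positivity, fun x hx ε hε hεr => ?_⟩
  have hx₁ := hx.trans_le (min_le_left _ _)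
  have hx₂ := hx.trans_le (min_le_right _ _)
  have hε₁ := hεr.trans_le (min_le_left _ _)
  have hε₂ := hεr.trans_le (min_le_right _ _)
  rw [gradient_mollify hG hw hε]
  set p₀ := mollify ε G x with hp₀
  set L := fderiv ℝ (H x) p₀
  have hint : Integrable fun y => mollifier ε (x - y) • (G y - p₀) :=
    integrable_mollifier_smul hε
      (hG.1.sub (continuous_const.locallyIntegrable (f := fun _ => p₀))) x
  have hint' : Integrable fun y => mollifier ε (x - y) • (g y - (H x p₀ - η / 2)) :=
    integrable_mollifier_smul hε
      (hg.1.sub (continuous_const.locallyIntegrable (f := fun _ => H x p₀ - η / 2))) x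
  -- Jensen's inequality by hand: the tangent plane of `H x` at the mean `p₀` has a linear part that
  -- averages to zero.
  have h0 : ∫ y, L (mollifier ε (x - y) • (G y - p₀)) = 0 := by
    rw [L.integral_comp_comm hint, ← mollify_sub_const hε hG.1, hp₀, sub_self, map_zero]
  have hle : 0 ≤ mollify ε g x - (H x p₀ - η / 2) := by
    rw [mollify_sub_const hε hg.1, ← h0]
    refine integral_mono_ae (L.integrable_comp hint) hint' ?_
    filter_upwards [hae, hK] with y hy hKy
    rw [map_smul, smul_eq_mul, smul_eq_mul]
    by_cases hxy : ‖y - x‖ < ε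
    · refine mul_le_mul_of_nonneg_left ?_ (mollifier_nonneg hε _)
      have h3 := add_fderiv_le_of_convexOn (hH.convex x) (hH.differentiable x p₀) (G y)
      have h4 := h₂ x y (G y) (by linarith) (by
        linarith [norm_sub_le_norm_sub_add_norm_sub y x x₀]) hKy
      linarith
    · rw [mollifier_eq_zero hε (by rw [norm_sub_rev]; exact not_lt.1 hxy)]
      simp
  have := (abs_le.1 (h₁ x hx₁ ε hε hε₁)).1
  linarith

theorem isViscositySubsolution_of_ae (hH : IsHamiltonian H) (hG : IsWeakGradient w G)
    (hg : IsWeakMulLaplacian a w g) (hw : Continuous w) (ha : IsDiffusionCoefficient a)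
    (hK : ∀ᵐ y, ‖G y‖ ≤ K) (hK0 : 0 ≤ K) (hM : ∀ᵐ y, |g y| ≤ M) (hM0 : 0 ≤ M)
    (hae : ∀ᵐ y, H y (G y) ≤ g y) : IsViscositySubsolution H a w := by
  intro φ x₀ hφ hmax
  by_contra! hlt
  set d : ℝ := ((Module.finrank ℝ (EuclideanSpace ℝ (Fin n)) : ℕ) : ℝ)
  -- The defect of the test function `φ + s‖· - x₀‖²` as a function of position and `s`. Continuity
  -- keeps it above `θ` for small `s` near `x₀`.
  set A : EuclideanSpace ℝ (Fin n) × ℝ → ℝ := fun z =>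
    H z.1 (∇ φ z.1 + (2 * z.2) • (z.1 - x₀)) -
      a z.1 * (Laplacian.laplacian φ z.1 + 2 * z.2 * d) with hA
  have hAcont : Continuous A := by
    have h1 : Continuous fun z : EuclideanSpace ℝ (Fin n) × ℝ =>
        ∇ φ z.1 + (2 * z.2) • (z.1 - x₀) :=
      ((continuous_gradient (hφ.of_le one_le_two)).comp continuous_fst).add (by fun_prop)
    have h2 : Continuous fun z : EuclideanSpace ℝ (Fin n) × ℝ => H z.1 (∇ φ z.1 +
        (2 * z.2) • (z.1 - x₀)) := hH.continuous.comp (continuous_fst.prodMk h1)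
    exact h2.sub ((ha.contDiff.continuous.comp continuous_fst).mul
      (((continuous_laplacian hφ).comp continuous_fst).add (by fun_prop)))
  have hA0 : 0 < A (x₀, 0) := by
    simp only [hA]
    simpa using hlt
  set θ := A (x₀, 0) / 2 with hθ
  have hθ0 : 0 < θ := half_pos hA0
  obtain ⟨r₁, hr₁, h₁⟩ := Metric.eventually_nhds_iff.1
    (hAcont.continuousAt.eventually (lt_mem_nhds (half_lt_self hA0)))
  obtain ⟨r₂, hr₂, h₂⟩ := exists_mollify_subsolution hH hG hg hw ha hK hK0 hM hM0 hae x₀ hθ0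
  obtain ⟨r₃, hr₃, h₃⟩ := Metric.eventually_nhds_iff.1 hmax
  obtain ⟨r, hr, hrr⟩ : ∃ r : ℝ, 0 < r ∧ r < min r₁ (min r₂ r₃) :=
    exists_between (by positivity)
  obtain ⟨hrr₁, hrr₂, hrr₃⟩ : r < r₁ ∧ r < r₂ ∧ r < r₃ := by simpa using hrr
  -- The penalty on the sphere, `r * r ^ 2`, must exceed the mollification error `2 K ε`.
  obtain ⟨ε, hε, hεr⟩ : ∃ ε : ℝ, 0 < ε ∧ ε < min r₂ (r * r ^ 2 / (2 * K + 1)) :=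
    exists_between (by positivity)
  obtain ⟨hεr₂, hεK⟩ : ε < r₂ ∧ ε < r * r ^ 2 / (2 * K + 1) := by simpa using hεr
  rw [lt_div_iff₀ (by positivity)] at hεK
  have hu : ContDiff ℝ 2 (mollify ε w) := contDiff_mollify hε hw.locallyIntegrable
  have hq : ContDiff ℝ 2 fun z => r * ‖z - x₀‖ ^ 2 := contDiff_const_mul_normSq r x₀
  have hφ' : ContDiff ℝ 2 fun z => φ z + r * ‖z - x₀‖ ^ 2 := hφ.add hq
  obtain ⟨x, hx, hxmax⟩ := exists_isLocalMax_mem_ball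
    (f := fun z => mollify ε w z - (φ z + r * ‖z - x₀‖ ^ 2))
    (hu.continuous.sub hφ'.continuous) hr (x₀ := x₀) fun z hz => by
      have hz' : ‖z - x₀‖ = r := by simpa [dist_eq_norm] using hz
      have e1 := h₃ (y := z) (by rw [dist_eq_norm, hz']; exact hrr₃)
      have e2 := (abs_le.1 (abs_mollify_sub_le hG hw hK hK0 hε z)).2
      have e3 := (abs_le.1 (abs_mollify_sub_le hG hw hK hK0 hε x₀)).1
      simp only [hz', sub_self, norm_zero]
      nlinarith
  have hx' : ‖x - x₀‖ < r := by simpa [dist_eq_norm] using hx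
  have hgrad : ∇ (mollify ε w) x = ∇ φ x + (2 * r) • (x - x₀) := by
    rw [gradient_eq_of_isLocalMax_sub hu hφ' hxmax, gradient_add_apply
      (hφ.differentiable two_ne_zero x) (hq.differentiable two_ne_zero x),
      (hasGradientAt_const_mul_normSq r x₀ x).gradient]
  have hlap : Laplacian.laplacian (mollify ε w) x ≤ Laplacian.laplacian φ x + 2 * r * d := by
    refine (laplacian_le_of_isLocalMax_sub hu hφ' hxmax).trans_eq ?_
    rw [← laplacian_const_mul_normSq r x₀ x]
    exact ContDiffAt.laplacian_add hφ.contDiffAt hq.contDiffAt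
  have e1 := h₂ x (hx'.trans hrr₂) ε hε hεr₂
  have e2 := mul_le_mul_of_nonneg_left hlap (ha.nonneg x)
  have e3 : θ < A (x, r) := h₁ (y := (x, r)) (by
    rw [Prod.dist_eq, max_lt_iff, dist_eq_norm, Real.dist_eq, sub_zero, abs_of_pos hr]
    exact ⟨hx'.trans hrr₁, hrr₁⟩)
  rw [hgrad] at e1
  simp only [hA] at e3
  linarith

/-- Touching `w` from above by its own mollification plus a paraboloid. -/
theorem IsViscositySubsolution.exists_mem_ball (hv : IsViscositySubsolution H a w)
    (hG : IsWeakGradient w G) (hw : Continuous w) {x₀ : EuclideanSpace ℝ (Fin n)}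
    {ε R c m : ℝ} (hε : 0 < ε) (hR : 0 < R)
    (hm : ∀ x, ‖x - x₀‖ ≤ R → |mollify ε w x - w x| ≤ m) (hc : 2 * m < c * R ^ 2) :
    ∃ x, ‖x - x₀‖ < R ∧ H x (mollify ε G x + (2 * c) • (x - x₀)) ≤
      a x * Laplacian.laplacian (mollify ε w) x + a x * (2 * c * n) := by
  have hu : ContDiff ℝ 2 (mollify ε w) := contDiff_mollify hε hw.locallyIntegrable
  have hq : ContDiff ℝ 2 fun z => c * ‖z - x₀‖ ^ 2 := contDiff_const_mul_normSq c x₀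
  have hφ' : ContDiff ℝ 2 fun z => mollify ε w z + c * ‖z - x₀‖ ^ 2 := hu.add hq
  obtain ⟨x, hx, hxmax⟩ := exists_isLocalMax_mem_ball
    (f := fun z => w z - (mollify ε w z + c * ‖z - x₀‖ ^ 2))
    (hw.sub hφ'.continuous) hR (x₀ := x₀) fun z hz => by
      have hz' : ‖z - x₀‖ = R := by simpa [dist_eq_norm] using hz
      have e2 := (abs_le.1 (hm z hz'.le)).1
      have e3 := (abs_le.1 (hm x₀ (by simpa using hR.le))).2
      simp only [hz', sub_self, norm_zero]
      nlinarith
  refine ⟨x, by simpa [dist_eq_norm] using hx, ?_⟩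
  have h := hv _ x hφ' hxmax
  have hlap : Laplacian.laplacian (fun z => mollify ε w z + c * ‖z - x₀‖ ^ 2) x =
      Laplacian.laplacian (mollify ε w) x + 2 * c * n := by
    have e := laplacian_const_mul_normSq c x₀ x
    rw [finrank_euclideanSpace_fin] at e
    rw [← e]
    exact ContDiffAt.laplacian_add hu.contDiffAt hq.contDiffAt
  rw [gradient_add_apply (hu.differentiable two_ne_zero x) (hq.differentiable two_ne_zero x),
    (hasGradientAt_const_mul_normSq c x₀ x).gradient, gradient_mollify hG hw hε, hlap, mul_add] at h
  exact h

/-- At comparable distance from `x₀`, a viscosity subsolution satisfies the mollified inequality up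
to a small error. -/
theorem IsViscositySubsolution.exists_mollified_le (hv : IsViscositySubsolution H a w)
    (hG : IsWeakGradient w G) (hg : IsWeakMulLaplacian a w g) (hw : Continuous w)
    (ha : IsDiffusionCoefficient a) (hK : ∀ᵐ y, ‖G y‖ ≤ K) (hK0 : 0 ≤ K)
    (hM : ∀ᵐ y, |g y| ≤ M) (hM0 : 0 ≤ M) (x₀ : EuclideanSpace ℝ (Fin n)) {η : ℝ} (hη : 0 < η) :
    ∃ N : ℕ, 0 < N ∧ ∃ r : ℝ, 0 < r ∧ ∀ ε, 0 < ε → ε < r → ∃ x q, ‖x - x₀‖ ≤ N * ε ∧ ‖q‖ ≤ η ∧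
      H x (mollify ε G x + q) ≤ mollify ε g x + η := by
  obtain ⟨r₁, hr₁, h₁⟩ := exists_abs_mul_laplacian_mollify_sub_le hG hg hw ha hK hK0 hM hM0 x₀
    (half_pos hη)
  -- The curvature `c` must be large enough to localise the maximum, yet small in its effects on the
  -- gradient and on `aΔ`.
  suffices hsuff : ∃ N : ℕ, 0 < N ∧ ∃ r : ℝ, 0 < r ∧ ∀ ε, 0 < ε → ε < r → ∃ c m : ℝ,
      0 ≤ c ∧ (∀ x, ‖x - x₀‖ ≤ N * ε → |mollify ε w x - w x| ≤ m) ∧ 2 * m < c * (N * ε) ^ 2 ∧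
      2 * c * (N * ε) ≤ η ∧ ∀ x, ‖x - x₀‖ ≤ N * ε → a x * (2 * c * n) ≤ η / 2 by
    obtain ⟨N, hN, r, hr, h⟩ := hsuff
    have hN' : (1 : ℝ) ≤ N := by exact_mod_cast hN
    refine ⟨N, hN, min r (r₁ / N), by positivity, fun ε hε hεr => ?_⟩
    obtain ⟨hε₁, hε₂⟩ := lt_min_iff.1 hεr
    rw [lt_div_iff₀ (by positivity)] at hε₂
    have hε₃ : ε < r₁ := lt_of_le_of_lt (le_mul_of_one_le_right hε.le hN') hε₂
    obtain ⟨c, m, hc, hm, hcm, hcη, hac⟩ := h ε hε hε₁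
    obtain ⟨x, hx, hHx⟩ := hv.exists_mem_ball hG hw hε (by positivity) hm hcm
    refine ⟨x, (2 * c) • (x - x₀), hx.le, ?_, ?_⟩
    · rw [norm_smul, Real.norm_of_nonneg (by positivity)]
      exact (mul_le_mul_of_nonneg_left hx.le (by positivity)).trans hcη
    · have e1 := (abs_le.1 (h₁ x (by linarith) ε hε hε₃)).2
      have e2 := hac x hx.le
      linarith
  rcases (ha.nonneg x₀).eq_or_lt with h0 | hpos
  · have hmin : IsLocalMin a x₀ := Filter.Eventually.of_forall fun y => by
      rw [← h0]
      exact ha.nonneg y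
    have hder : HasFDerivAt a (0 : EuclideanSpace ℝ (Fin n) →L[ℝ] ℝ) x₀ := by
      rw [← hmin.fderiv_eq_zero]
      exact (ha.contDiff.differentiable two_ne_zero x₀).hasFDerivAt
    obtain ⟨r, hr, hball⟩ := Metric.eventually_nhds_iff.1 (hder.isLittleO.def one_pos)
    obtain ⟨N, hN⟩ := exists_nat_gt (max (6 * (K + 1) / η) (12 * (K + 1) * n / η))
    obtain ⟨hN₁, hN₂⟩ := max_lt_iff.1 hN
    have hN0 : (0 : ℝ) < N := lt_of_le_of_lt (by positivity) hN₁
    rw [div_lt_iff₀ hη] at hN₁ hN₂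
    refine ⟨N, by exact_mod_cast hN0, r / N, by positivity, fun ε hε hεr => ?_⟩
    rw [lt_div_iff₀ hN0] at hεr
    -- With this `c` the paraboloid on the sphere is `3 (K + 1) ε > 2 K ε`. The gradient changes by
    -- at most `6 (K + 1) / N` and, as `a ≤ N ε` there, `aΔ` by at most `6 (K + 1) n / N`.
    refine ⟨3 * (K + 1) / (N ^ 2 * ε), K * ε, by positivity,
      fun x _ => abs_mollify_sub_le hG hw hK hK0 hε x, ?_, ?_, fun x hx => ?_⟩
    · have : 3 * (K + 1) / (N ^ 2 * ε) * (N * ε) ^ 2 = 3 * (K + 1) * ε := by field_simp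
      rw [this]
      nlinarith
    · have : 2 * (3 * (K + 1) / (N ^ 2 * ε)) * (N * ε) = 6 * (K + 1) / N := by field_simp; ring
      rw [this, div_le_iff₀ hN0]
      linarith
    · have hax : a x ≤ N * ε := by
        have := hball (y := x) (by rw [dist_eq_norm]; linarith)
        rw [← h0] at this
        simp only [sub_zero, zero_apply, one_mul] at this
        exact (le_abs_self _).trans (this.trans hx)
      refine (mul_le_mul_of_nonneg_right hax (by positivity)).trans ?_
      have : (N : ℝ) * ε * (2 * (3 * (K + 1) / (N ^ 2 * ε)) * n) = 6 * (K + 1) * n / N := by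
        field_simp
        ring
      rw [this, div_le_iff₀ hN0]
      linarith
  · obtain ⟨C, r₂, hC, hr₂, h₂⟩ := exists_abs_mollify_sub_le_sq hG hg hw ha.contDiff hK hK0 hM hM0
      hpos
    obtain ⟨r₃, hr₃, h₃⟩ := Metric.eventually_nhds_iff.1
      (ha.contDiff.continuous.continuousAt.eventually (gt_mem_nhds (lt_add_one (a x₀))))
    obtain ⟨N, hN⟩ := exists_nat_gt (max 1 ((a x₀ + 1) * (12 * C * n) / η))
    obtain ⟨hN₁, hN₂⟩ := max_lt_iff.1 hN
    have hN0 : (0 : ℝ) < N := one_pos.trans hN₁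
    rw [div_lt_iff₀ hη] at hN₂
    refine ⟨N, by exact_mod_cast hN0, min (η / (6 * C)) (min (r₂ / N) (r₃ / N)), by positivity,
      fun ε hε hεr => ?_⟩
    obtain ⟨hε₁, hε₂, hε₃⟩ : ε < η / (6 * C) ∧ ε < r₂ / N ∧ ε < r₃ / N := by
      simpa only [lt_min_iff] using hεr
    rw [lt_div_iff₀ (by positivity)] at hε₁ hε₂ hε₃
    have hεN : ε ≤ ε * N := le_mul_of_one_le_right hε.le hN₁.le
    -- The error `C ε²` permits a curvature independent of `ε`: small `ε` controls the gradient term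
    -- `6 C ε / N`, and large `N` the Laplacian term.
    refine ⟨3 * C / N ^ 2, C * ε ^ 2, by positivity,
      fun x hx => h₂ x (by linarith) ε hε (by linarith), ?_, ?_, fun x hx => ?_⟩
    · have : 3 * C / N ^ 2 * (N * ε) ^ 2 = 3 * (C * ε ^ 2) := by field_simp
      rw [this]
      have : 0 < C * ε ^ 2 := by positivity
      linarith
    · have : 2 * (3 * C / N ^ 2) * (N * ε) = 6 * C * ε / N := by field_simp; ring
      rw [this, div_le_iff₀ hN0]
      nlinarith
    · have hax : a x ≤ a x₀ + 1 := (h₃ (y := x) (by rw [dist_eq_norm]; linarith)).le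
      refine (mul_le_mul_of_nonneg_right hax (by positivity)).trans ?_
      have : (a x₀ + 1) * (2 * (3 * C / N ^ 2) * n) = (a x₀ + 1) * (12 * C * n) / N / N / 2 := by
        field_simp
        ring
      rw [this]
      have h5 : (a x₀ + 1) * (12 * C * n) / N ≤ η := by
        rw [div_le_iff₀ hN0]
        linarith
      have h6 : (a x₀ + 1) * (12 * C * n) / N / N ≤ η := by
        rw [div_le_iff₀ hN0]
        nlinarith
      linarith

/-- The centre `X ε` moves with `ε`, because the touching point is only known to lie within `N ε` of
`x₀`. -/
theorem tendsto_mollify_of_tendsto_average {F : Type*} [NormedAddCommGroup F] [NormedSpace ℝ F]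
    [CompleteSpace F] {f : EuclideanSpace ℝ (Fin n) → F} (hf : LocallyIntegrable f) {c : F}
    {X : ℝ → EuclideanSpace ℝ (Fin n)}
    (h : Filter.Tendsto (fun ε => ⨍ y in Metric.closedBall (X ε) ε, ‖f y - c‖)
      (nhdsWithin 0 (Set.Ioi 0)) (nhds 0)) :
    Filter.Tendsto (fun ε => mollify ε f (X ε)) (nhdsWithin 0 (Set.Ioi 0)) (nhds c) := by
  obtain ⟨C, -, hC⟩ := exists_norm_mollify_sub_le_average (E := EuclideanSpace ℝ (Fin n)) (F := F)
  rw [tendsto_iff_norm_sub_tendsto_zero]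
  refine squeeze_zero' (Filter.Eventually.of_forall fun _ => norm_nonneg _) ?_
    (by simpa using h.const_mul C)
  filter_upwards [self_mem_nhdsWithin] with ε hε using hC f hf ε hε (X ε) c

theorem IsViscositySubsolution.ae_le (hv : IsViscositySubsolution H a w) (hH : IsHamiltonian H)
    (hG : IsWeakGradient w G) (hg : IsWeakMulLaplacian a w g) (hw : Continuous w)
    (ha : IsDiffusionCoefficient a) (hK : ∀ᵐ y, ‖G y‖ ≤ K) (hK0 : 0 ≤ K)
    (hM : ∀ᵐ y, |g y| ≤ M) (hM0 : 0 ≤ M) : ∀ᵐ x, H x (G x) ≤ g x := by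
  -- Lebesgue differentiation along balls not centred at `x₀`, but whose `N`-fold enlargement
  -- contains it. As `N` depends on `x₀`, all `N` share one null set.
  have hLG := ae_all_iff.2 fun N : ℕ =>
    IsUnifLocDoublingMeasure.ae_tendsto_average_norm_sub volume hG.1 (N : ℝ)
  have hLg := ae_all_iff.2 fun N : ℕ =>
    IsUnifLocDoublingMeasure.ae_tendsto_average_norm_sub volume hg.1 (N : ℝ)
  filter_upwards [hLG, hLg] with x₀ hxG hxg
  by_contra! hlt
  -- A quarter of the gap: continuity of `H`, convergence of the mollified `g`, and the error in the
  -- mollified inequality cost at most `β` each.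
  set β := (H x₀ (G x₀) - g x₀) / 4 with hβ
  have hβ0 : 0 < β := by
    rw [hβ]
    linarith
  obtain ⟨θ, hθ, hball⟩ := Metric.eventually_nhds_iff.1 ((hH.continuous.continuousAt
    (x := (x₀, G x₀))).eventually (lt_mem_nhds (sub_lt_self (H x₀ (G x₀)) hβ0)))
  obtain ⟨N, hN, r, hr, h⟩ := hv.exists_mollified_le hG hg hw ha hK hK0 hM hM0 x₀
    (lt_min (half_pos hθ) hβ0)
  have hN0 : (0 : ℝ) < N := by exact_mod_cast hN
  -- The limit needs functions of every real `ε`; outside `(0, r)` the values `x₀` and `0` are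
  -- placeholders.
  have h' : ∀ ε, ∃ x q, 0 < ε → ε < r → ‖x - x₀‖ ≤ N * ε ∧ ‖q‖ ≤ min (θ / 2) β ∧
      H x (mollify ε G x + q) ≤ mollify ε g x + min (θ / 2) β := by
    intro ε
    by_cases hε : 0 < ε ∧ ε < r
    · obtain ⟨x, q, hxq⟩ := h ε hε.1 hε.2
      exact ⟨x, q, fun _ _ => hxq⟩
    · exact ⟨x₀, 0, fun h1 h2 => absurd ⟨h1, h2⟩ hε⟩
  choose X Q hXQ using h'
  have hmem : ∀ᶠ ε in nhdsWithin (0 : ℝ) (Set.Ioi 0),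
      x₀ ∈ Metric.closedBall (X ε) (N * id ε) := by
    filter_upwards [Ioo_mem_nhdsGT hr] with ε hε
    rw [mem_closedBall_iff_norm, norm_sub_rev]
    exact (hXQ ε hε.1 hε.2).1
  have hTG := tendsto_mollify_of_tendsto_average hG.1 (hxG N X id Filter.tendsto_id hmem)
  have hTg := tendsto_mollify_of_tendsto_average hg.1 (hxg N X id Filter.tendsto_id hmem)
  have hsmall : Set.Ioo 0 (min r (θ / N)) ∈ nhdsWithin (0 : ℝ) (Set.Ioi 0) :=
    Ioo_mem_nhdsGT (by positivity)
  obtain ⟨ε, hε, hεG, hεg⟩ := (Filter.Eventually.and hsmall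
    ((Metric.tendsto_nhds.1 hTG _ (half_pos hθ)).and (Metric.tendsto_nhds.1 hTg _ hβ0))).exists
  obtain ⟨hε₁, hε₂⟩ := lt_min_iff.1 hε.2
  rw [lt_div_iff₀ hN0] at hε₂
  obtain ⟨hX, hQ, hle⟩ := hXQ ε hε.1 hε₁
  have hlow := hball (y := (X ε, mollify ε G (X ε) + Q ε)) (by
    rw [Prod.dist_eq, max_lt_iff]
    constructor
    · rw [dist_eq_norm]
      linarith
    · rw [dist_eq_norm] at hεG ⊢
      have e1 : mollify ε G (X ε) + Q ε - G x₀ = (mollify ε G (X ε) - G x₀) + Q ε := by abel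
      have e2 := norm_add_le (mollify ε G (X ε) - G x₀) (Q ε)
      have e3 := hQ.trans (min_le_left _ _)
      simp only [e1]
      linarith)
  rw [Real.dist_eq] at hεg
  have e1 := (abs_lt.1 hεg).2
  have e2 := min_le_right (θ / 2) β
  simp only at hlow
  linarith

theorem IsWeakGradient.ae_eq {G' : EuclideanSpace ℝ (Fin n) → EuclideanSpace ℝ (Fin n)}
    (hG : IsWeakGradient w G) (hG' : IsWeakGradient w G') : ∀ᵐ x, G x = G' x :=
  ae_eq_of_integral_contDiff_smul_eq hG.1 hG'.1 fun φ hφ hc => by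
    have h1 : ContDiff ℝ 1 φ := contDiff_infty.1 hφ 1
    exact neg_injective ((hG.2 φ h1 hc).symm.trans (hG'.2 φ h1 hc))

theorem IsWeakMulLaplacian.ae_eq {g' : EuclideanSpace ℝ (Fin n) → ℝ}
    (hg : IsWeakMulLaplacian a w g) (hg' : IsWeakMulLaplacian a w g') : ∀ᵐ x, g x = g' x :=
  ae_eq_of_integral_contDiff_smul_eq hg.1 hg'.1 fun φ hφ hc => by
    have h2 : ContDiff ℝ 2 φ := contDiff_infty.1 hφ 2
    simpa only [smul_eq_mul, mul_comm] using (hg.2 φ h2 hc).symm.trans (hg'.2 φ h2 hc)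

theorem exists_ae_norm_le_of_memLp_top {F : Type*} [NormedAddCommGroup F]
    {f : EuclideanSpace ℝ (Fin n) → F} (hf : MemLp f ∞) : ∃ K : ℝ, 0 ≤ K ∧ ∀ᵐ y, ‖f y‖ ≤ K := by
  refine ⟨(eLpNormEssSup f volume).toReal, ENNReal.toReal_nonneg, ?_⟩
  have hfin : eLpNormEssSup f volume ≠ ∞ := by
    have := hf.2.ne
    rwa [eLpNorm_exponent_top] at this
  filter_upwards [ae_le_eLpNormEssSup (f := f) (μ := volume)] with y hy
  have := ENNReal.toReal_mono hfin hy
  simpa using this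

end Equivalence

end DegenerateHJ

theorem proposition3p3 {n : ℕ} (hn : 1 ≤ n)
    (H : EuclideanSpace ℝ (Fin n) → EuclideanSpace ℝ (Fin n) → ℝ)
    (hH : DegenerateHJ.IsHamiltonian H)
    (a : EuclideanSpace ℝ (Fin n) → ℝ) (ha : DegenerateHJ.IsDiffusionCoefficient a)
    (w : EuclideanSpace ℝ (Fin n) → ℝ) (hw : Continuous w)
    (hw_per : DegenerateHJ.IsPeriodic w)
    (hw_bdd : DegenerateHJ.HasBoundedGradientAndMulLaplacian a w) :
    DegenerateHJ.IsViscositySubsolution H a w ↔ DegenerateHJ.IsAESubsolution H a w := by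
  obtain ⟨G, g, hG, hg, hGb, hgb⟩ := hw_bdd
  obtain ⟨K, hK0, hK⟩ := DegenerateHJ.exists_ae_norm_le_of_memLp_top hGb
  obtain ⟨M, hM0, hM⟩ := DegenerateHJ.exists_ae_norm_le_of_memLp_top hgb
  constructor
  · exact fun hv => ⟨G, g, hG, hg, hv.ae_le hH hG hg hw ha hK hK0 hM hM0⟩
  -- These representatives carry no bounds; uniqueness of weak derivatives transfers the inequality
  -- to the bounded `G` and `g`.
  · rintro ⟨G', g', hG', hg', hae⟩
    refine DegenerateHJ.isViscositySubsolution_of_ae hH hG hg hw ha hK hK0 hM hM0 ?_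
    filter_upwards [hae, hG.ae_eq hG', hg.ae_eq hg'] with x hx h1 h2
    rwa [h1, h2]
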